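/- Let $p$ be a natural number. For a constant square matrix $\Sigma$ that is Hermitian and unitary, a square rational matrix function $R(z)$ over $\mathbb C$ is called $\Sigma$-inner if at every point of analyticity $z$ of $R$ one has $R(z)^*\Sigma R(z)\le\Sigma$ if $|z|<1$, $R(z)^*\Sigma R(z)=\Sigma$ if $|z|=1$, and $R(z)^*\Sigma R(z)\ge\Sigma$ if $|z|>1$. A $p\times p$ rational function $G$ is lossless if it is $(-I_p)$-inner. Let $J=\begin{bmatrix}I_p&0\\0&-I_p\end{bmatrix}$. An elementary $J$-inner factor is a $2p\times 2p$ $J$-inner function of McMillan degree $1$, where the McMillan degree of a rational matrix function is the sum of the degrees of all its poles, including a pole at infinity. For $\Theta=\begin{bmatrix}\Theta_1&\Theta_2\\\Theta_3&\Theta_4\end{bmatrix}$ with $p\times p$ blocks let $\mathcal T_\Theta(G)=(\Theta_4G+\Theta_3)(\Theta_2G+\Theta_1)^{-1}$. For $(p+1)\times(p+1)$ matrices $U,V$ let $$\mathcal F_{U,V}(G)(z)=F_1(z)+\frac{F_2(z)F_3(z)}{z-F_4(z)},\qquad \begin{bmatrix}F_1(z)&F_2(z)\\F_3(z)&F_4(z)\end{bmatrix}=V\begin{bmatrix}1&0\\0&G(z)\end{bmatrix}U^*,$$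 with $F_1$ of size $p\times p$ and $F_4$ scalar. We say that $\mathcal T_\Theta$ coincides with $\mathcal F_{U,V}$ if for every $p\times p$ lossless $G$ (of any McMillan degree) both are defined at $G$, that is, $\Theta_2G+\Theta_1$ is invertible over $\mathbb C(z)$ and $z-F_4(z)$ is not identically zero, and $\mathcal T_\Theta(G)=\mathcal F_{U,V}(G)$. For $u,v\in\mathbb C^p$ with $\|u\|=1$, $\|v\|<1$, and $w\in\mathbb C$ with $|w|<1$, put $$\widehat\Theta(u,v,w)(z)=H(uv^*)\,S_{u,w}(z)\,H(\overline w\,uv^*),\quad S_{u,w}(z)=\begin{bmatrix}I_p-(1-b_w(z))uu^*&0\\0&I_p\end{bmatrix},\quad b_w(z)=\frac{z-w}{1-\overline wz},$$ where, for a strictly contractive $p\times p$ matrix $E$, $$H(E)=\begin{bmatrix}(I-EE^*)^{-1/2}&E(I-E^*E)^{-1/2}\\E^*(I-EE^*)^{-1/2}&(I-E^*E)^{-1/2}\end{bmatrix}.$$ **Theorem.** Let $\Theta(z)$ be an elementary $J$-inner factor of size $2p\times2p$ that is analytic on the closed unit disk. (a) If $\mathcal T_\Theta$ coincides with a mapping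 $\mathcal F_{U,V}$ for some unitary $(p+1)\times(p+1)$ matrices $U,V$, then $$\Theta(z)=\widehat\Theta(u,v,w)(z)\begin{bmatrix}P&0\\0&Q\end{bmatrix}\qquad(*)$$ for some $u,v\in\mathbb C^p$ with $\|u\|=1$, $\|v\|<1$, some $w\in\mathbb C$ with $|w|<1$, and some unitary $p\times p$ matrices $P,Q$. (b) Whenever $(*)$ holds for such $u,v,w,P,Q$, the matrices $$U=\widehat U\begin{bmatrix}1&0\\0&P\end{bmatrix},\qquad V=\widehat V\begin{bmatrix}1&0\\0&Q\end{bmatrix}$$ are unitary and $\mathcal T_\Theta$ coincides with $\mathcal F_{U,V}$, where $$\widehat U=\begin{bmatrix}\frac{\sqrt{1-|w|^2}}{\sqrt{1-|w|^2\|v\|^2}}u&I_p-\Bigl(1+\frac{w\sqrt{1-\|v\|^2}}{\sqrt{1-|w|^2\|v\|^2}}\Bigr)uu^*\\[2mm]\frac{\overline w\sqrt{1-\|v\|^2}}{\sqrt{1-|w|^2\|v\|^2}}&\frac{\sqrt{1-|w|^2}}{\sqrt{1-|w|^2\|v\|^2}}u^*\end{bmatrix},$$ $$\widehat V=\begin{bmatrix}\frac{\sqrt{1-|w|^2}}{\sqrt{1-|w|^2\|v\|^2}}v&I_p-\Bigl(1-\frac{\sqrt{1-\|v\|^2}}{\sqrt{1-|w|^2\|v\|^2}}\Bigr)\frac{vv^*}{\|v\|^2}\\[2mm]\frac{\sqrt{1-\|v\|^2}}{\sqrt{1-|w|^2\|v\|^2}}&-\frac{\sqrt{1-|w|^2}}{\sqrt{1-|w|^2\|v\|^2}}v^*\end{bmatrix}$$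 (the term with $vv^*/\|v\|^2$ being read as $0$ if $v=0$). -/

import Mathlib

noncomputable section

namespace Lossless

open Matrix
open scoped ComplexOrder MatrixOrder

/-- Rational matrix functions: matrices over the field `ℂ(z)`. The variable `z` is `RatFunc.X`. -/
abbrev RatMat (m n : Type) : Type := Matrix m n (RatFunc ℂ)

/-- A constant matrix, regarded as a rational matrix function. -/
def const {m n : Type} (M : Matrix m n ℂ) : RatMat m n := M.map RatFunc.C

/-- `z₀` is a point of analyticity of `R`: no entry, in lowest terms, has a pole at `z₀`. -/
def AnalyticAtPt {m n : Type} (R : RatMat m n) (z₀ : ℂ) : Prop :=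
  ∀ i j, (R i j).denom.eval z₀ ≠ 0

/-- The value `R(z₀)`; meaningful at points of analyticity. -/
def evalAt {m n : Type} (R : RatMat m n) (z₀ : ℂ) : Matrix m n ℂ :=
  R.map (RatFunc.eval (RingHom.id ℂ) z₀)

/-- `Σ`-inner rational matrix functions (in the unit disk), for a constant matrix `Σ` (here `Sg`): at every
point of analyticity, `R(z)* Σ R(z)` is `≤ Σ`, `= Σ`, `≥ Σ` according to whether
`|z| < 1`, `|z| = 1`, `|z| > 1`. -/
def IsInner {k : Type} [Fintype k] (Sg : Matrix k k ℂ) (R : RatMat k k) : Prop :=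
  ∀ z : ℂ, AnalyticAtPt R z →
    (‖z‖ < 1 → (Sg - (evalAt R z)ᴴ * Sg * evalAt R z).PosSemidef) ∧
    (‖z‖ = 1 → (evalAt R z)ᴴ * Sg * evalAt R z = Sg) ∧
    (1 < ‖z‖ → ((evalAt R z)ᴴ * Sg * evalAt R z - Sg).PosSemidef)

/-- The `2p × 2p` signature matrix `J = diag(I, -I)`. -/
def J (p : ℕ) : Matrix (Fin p ⊕ Fin p) (Fin p ⊕ Fin p) ℂ := fromBlocks 1 0 0 (-1)

/-- `p × p` (discrete-time) lossless functions: the `(-I)`-inner ones. -/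
def IsLossless {p : ℕ} (G : RatMat (Fin p) (Fin p)) : Prop := IsInner (-1) G

/-- `R` is the sum of a proper part `D + C (z I - A)⁻¹ B` with state space of dimension `n₁` and of
a polynomial part `z C' (I - z N)⁻¹ B'`, `N` nilpotent, with state space of dimension `n₂`. The
latter is `C' (s I - N)⁻¹ B'` in the local coordinate `s = 1/z` at infinity, so that it realizes
the pole at infinity. -/
def HasRealization {m n : Type} (R : RatMat m n) (n₁ n₂ : ℕ) : Prop :=
  ∃ (D : Matrix m n ℂ)
    (A : Matrix (Fin n₁) (Fin n₁) ℂ) (B : Matrix (Fin n₁) n ℂ) (C : Matrix m (Fin n₁) ℂ)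
    (N : Matrix (Fin n₂) (Fin n₂) ℂ) (B' : Matrix (Fin n₂) n ℂ) (C' : Matrix m (Fin n₂) ℂ),
    IsNilpotent N ∧
    R = const D
      + const C * ((RatFunc.X : RatFunc ℂ) • (1 : RatMat (Fin n₁) (Fin n₁)) - const A)⁻¹ * const B
      + (RatFunc.X : RatFunc ℂ) •
          (const C' * (1 - (RatFunc.X : RatFunc ℂ) • const N)⁻¹ * const B')

/-- The McMillan degree of a rational (not necessarily proper) matrix function: the sum of the
degrees of all its poles, the one at infinity included, i.e. the smallest total state space
dimension of a realization of its finite poles and its pole at infinity. For a proper function it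
is the smallest dimension of a realization `D + C (z I - A)⁻¹ B`. -/
def mcMillanDegree {m n : Type} (R : RatMat m n) : ℕ :=
  sInf {d : ℕ | ∃ n₁ n₂ : ℕ, n₁ + n₂ = d ∧ HasRealization R n₁ n₂}

/-- Elementary `J`-inner factors: `J`-inner functions of McMillan degree one. -/
def IsElementaryJInner {p : ℕ} (T : RatMat (Fin p ⊕ Fin p) (Fin p ⊕ Fin p)) : Prop :=
  IsInner (J p) T ∧ mcMillanDegree T = 1

/-- `G` is in the domain of the linear fractional transformation of `T`: the matrix
`T₂ G + T₁` is invertible over `ℂ(z)`. -/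
def InDomain {p : ℕ} (T : RatMat (Fin p ⊕ Fin p) (Fin p ⊕ Fin p)) (G : RatMat (Fin p) (Fin p)) :
    Prop :=
  IsUnit (T.toBlocks₁₂ * G + T.toBlocks₁₁)

/-- The linear fractional transformation `G ↦ (T₄ G + T₃) (T₂ G + T₁)⁻¹`. -/
def lft {p : ℕ} (T : RatMat (Fin p ⊕ Fin p) (Fin p ⊕ Fin p)) (G : RatMat (Fin p) (Fin p)) :
    RatMat (Fin p) (Fin p) :=
  (T.toBlocks₂₂ * G + T.toBlocks₂₁) * (T.toBlocks₁₂ * G + T.toBlocks₁₁)⁻¹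

/-- `(p+1) × (p+1)` matrices with rows split as `(p, 1)` and columns split as `(1, p)`. -/
abbrev BlockMat (p : ℕ) : Type := Matrix (Fin p ⊕ Unit) (Unit ⊕ Fin p) ℂ

/-- Unitarity (the row and column index types have the same cardinality). -/
def IsUnitary {p : ℕ} (U : BlockMat p) : Prop := U * Uᴴ = 1 ∧ Uᴴ * U = 1

/-- The matrix function `F(z) = V diag(1, G(z)) U*`. -/
def Fmat {p : ℕ} (U V : BlockMat p) (G : RatMat (Fin p) (Fin p)) :
    RatMat (Fin p ⊕ Unit) (Fin p ⊕ Unit) :=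
  const V * (fromBlocks 1 0 0 G : RatMat (Unit ⊕ Fin p) (Unit ⊕ Fin p)) * const (Uᴴ)

/-- The scalar function `z - F₄(z)`. -/
def Fden {p : ℕ} (U V : BlockMat p) (G : RatMat (Fin p) (Fin p)) : RatFunc ℂ :=
  RatFunc.X - (Fmat U V G).toBlocks₂₂ () ()

/-- The mapping `F_{U,V} : G ↦ F₁ + F₂ F₃ / (z - F₄)`. -/
def FUV {p : ℕ} (U V : BlockMat p) (G : RatMat (Fin p) (Fin p)) : RatMat (Fin p) (Fin p) :=
  (Fmat U V G).toBlocks₁₁ +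
    (Fden U V G)⁻¹ • ((Fmat U V G).toBlocks₁₂ * (Fmat U V G).toBlocks₂₁)

/-- The linear fractional transformation of `T` and the mapping `F_{U,V}` are defined at, and
agree on, all lossless functions. -/
def CoincideOnLossless {p : ℕ} (T : RatMat (Fin p ⊕ Fin p) (Fin p ⊕ Fin p)) (U V : BlockMat p) :
    Prop :=
  ∀ G : RatMat (Fin p) (Fin p), IsLossless G →
    InDomain T G ∧ Fden U V G ≠ 0 ∧ lft T G = FUV U V G

/-- The rank-one matrix `u v*`. -/
def outer {p : ℕ} (u v : EuclideanSpace ℂ (Fin p)) : Matrix (Fin p) (Fin p) ℂ :=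
  Matrix.of fun i j => u i * star (v j)

/-- A vector as a column. -/
def col {p : ℕ} (u : EuclideanSpace ℂ (Fin p)) : Matrix (Fin p) Unit ℂ :=
  Matrix.of fun i _ => u i

/-- `M^{-1/2}` for a positive definite matrix `M`: the inverse of its positive square root. -/
def invSqrt {p : ℕ} (M : Matrix (Fin p) (Fin p) ℂ) : Matrix (Fin p) (Fin p) ℂ := (CFC.sqrt M)⁻¹

/-- The Halmos extension `H(E)` of a strictly contractive matrix `E`. -/
def halmos {p : ℕ} (E : Matrix (Fin p) (Fin p) ℂ) : Matrix (Fin p ⊕ Fin p) (Fin p ⊕ Fin p) ℂ :=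
  fromBlocks (invSqrt (1 - E * Eᴴ)) (E * invSqrt (1 - Eᴴ * E))
    (Eᴴ * invSqrt (1 - E * Eᴴ)) (invSqrt (1 - Eᴴ * E))

/-- The Blaschke factor `b_w(z) = (z - w) / (1 - w̄ z)`. -/
def blaschke (w : ℂ) : RatFunc ℂ :=
  (RatFunc.X - RatFunc.C w) / (1 - RatFunc.C (star w) * RatFunc.X)

/-- `S_{u,w}(z) = diag(I - (1 - b_w(z)) u u*, I)`. -/
def S {p : ℕ} (u : EuclideanSpace ℂ (Fin p)) (w : ℂ) : RatMat (Fin p ⊕ Fin p) (Fin p ⊕ Fin p) :=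
  fromBlocks (1 - (1 - blaschke w) • const (outer u u)) 0 0 1

/-- `Θ̂(u,v,w)(z) = H(u v*) S_{u,w}(z) H(w̄ u v*)`. -/
def thetaHat {p : ℕ} (u v : EuclideanSpace ℂ (Fin p)) (w : ℂ) :
    RatMat (Fin p ⊕ Fin p) (Fin p ⊕ Fin p) :=
  const (halmos (outer u v)) * S u w * const (halmos (star w • outer u v))

/-- `√(1 - |w|²) / √(1 - |w|² ‖v‖²)`. -/
def cA {p : ℕ} (v : EuclideanSpace ℂ (Fin p)) (w : ℂ) : ℂ :=
  ((√(1 - ‖w‖ ^ 2) / √(1 - ‖w‖ ^ 2 * ‖v‖ ^ 2) : ℝ) : ℂ)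

/-- `√(1 - ‖v‖²) / √(1 - |w|² ‖v‖²)`. -/
def cK {p : ℕ} (v : EuclideanSpace ℂ (Fin p)) (w : ℂ) : ℂ :=
  ((√(1 - ‖v‖ ^ 2) / √(1 - ‖w‖ ^ 2 * ‖v‖ ^ 2) : ℝ) : ℂ)

/-- The matrix `Û`. -/
def Uhat {p : ℕ} (u v : EuclideanSpace ℂ (Fin p)) (w : ℂ) : BlockMat p :=
  fromBlocks (cA v w • col u) (1 - (1 + w * cK v w) • outer u u)
    (Matrix.of fun _ _ => star w * cK v w) (cA v w • (col u)ᴴ)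

/-- The matrix `V̂`; the term with `v v* / ‖v‖²` vanishes for `v = 0`. -/
def Vhat {p : ℕ} (v : EuclideanSpace ℂ (Fin p)) (w : ℂ) : BlockMat p :=
  fromBlocks (cA v w • col v) (1 - ((1 - cK v w) / ((‖v‖ ^ 2 : ℝ) : ℂ)) • outer v v)
    (Matrix.of fun _ _ => cK v w) (-(cA v w • (col v)ᴴ))

/-- `diag(P, Q)`. -/
def diagPQ {p : ℕ} (P Q : Matrix (Fin p) (Fin p) ℂ) :
    Matrix (Fin p ⊕ Fin p) (Fin p ⊕ Fin p) ℂ := fromBlocks P 0 0 Q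

/-- `diag(1, P)`. -/
def diagOne {p : ℕ} (P : Matrix (Fin p) (Fin p) ℂ) :
    Matrix (Unit ⊕ Fin p) (Unit ⊕ Fin p) ℂ := fromBlocks 1 0 0 P

end Lossless

end

/-! Part (b) is a computation with rank one matrices. With `β = b_w`, every block of `Θ̂` is a
combination of `I`, `uu*`, `uv*`, `vu*`, `vv*` (`thetaHat_eq`), and `G` enters the denominator only
through the scalar `g = v*Gu`. Hence `Θ̂₂G + Θ̂₁` is a rank one perturbation of `I`, governed by a
scalar `k + qg` which is a nonzero rational multiple of `z - F₄`. Clearing both denominators leaves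
the identity `feedback_mul_eq`. The denominator does not vanish identically: at a point of the unit
circle where `G` is unitary, `|F₄| < 1 = |z|` (`UnitaryOnCircle.Fden_ne_zero`). The factor
`diag(P,Q)` amounts to replacing `G` by `QGP*` on both sides.

For part (a), degree one and analyticity on the closed disk give `Θ = K + b_w · cr`
(`exists_eq_const_add_blaschke_smul`). Since `b_w` covers the unit circle, `J`-unitarity there can
be compared coefficientwise in `b_w`. This yields `Θ = (I - (1 - b_w) cc*J) M` with `c*Jc = 1` and
`M` `J`-unitary (`exists_factor`). Writing `c = H(uv*)[u; 0]` turns this into `Θ = Θ̂ M` for another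
constant `J`-unitary `M` (`exists_eq_thetaHat_mul`).

It remains to see that `M` is block diagonal. For a unitary constant `G` and `|l| = 1`, the image
`G' = T_M(lG)` is again unitary, and part (b) gives `F_{Û,V̂}(G') = F_{U,V}(lG)`. At a constant
argument a feedback map is `F₁ + F₂F₃/(z - F₄)` with constant blocks, so `F₁` and `F₂F₃` can be read
off. For `F_{U,V}(lG)` they are polynomials in `l` of degree at most two, and for `F_{Û,V̂}` they
determine `G'` linearly (`exists_quadratic`). So `T_M(lG)` is a polynomial in `l` of degree at most
two, and comparing coefficients for all unitary `G` forces the off-diagonal blocks of `M` to vanish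
(`eq_diag_of_quadratic`). -/

noncomputable section

namespace Lossless

open Matrix
open scoped ComplexOrder MatrixOrder

/-! ### Constant matrices inside rational matrices -/

section Const

variable {l m n : Type}

@[simp] lemma const_zero : const (0 : Matrix m n ℂ) = 0 := by
  ext i j; simp [const]

@[simp] lemma const_one [DecidableEq m] : const (1 : Matrix m m ℂ) = 1 :=
  Matrix.map_one _ (map_zero _) (map_one _)

lemma const_add (M N : Matrix m n ℂ) : const (M + N) = const M + const N := by
  ext i j; simp [const]

lemma const_sub (M N : Matrix m n ℂ) : const (M - N) = const M - const N := by
  ext i j; simp [const]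

lemma const_neg (M : Matrix m n ℂ) : const (-M) = -const M := by
  ext i j; simp [const]

lemma const_smul (c : ℂ) (M : Matrix m n ℂ) : const (c • M) = RatFunc.C c • const M := by
  ext i j; simp [const]

lemma const_mul [Fintype m] (M : Matrix l m ℂ) (N : Matrix m n ℂ) :
    const (M * N) = const M * const N :=
  Matrix.map_mul

lemma const_injective : Function.Injective (const : Matrix m n ℂ → RatMat m n) := by
  intro M N h
  ext i j
  exact RatFunc.C_injective (congrFun (congrFun h i) j)

lemma const_fromBlocks {o : Type} (A : Matrix n l ℂ) (B : Matrix n m ℂ) (C : Matrix o l ℂ)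
    (D : Matrix o m ℂ) :
    const (fromBlocks A B C D) = fromBlocks (const A) (const B) (const C) (const D) :=
  fromBlocks_map _ _ _ _ _

end Const

/-! ### Rank one matrices -/

section Outer

variable {p : ℕ}

lemma col_mul_conjTranspose_col (u v : EuclideanSpace ℂ (Fin p)) :
    col u * (col v)ᴴ = outer u v := by
  ext i j; simp [col, outer, Matrix.mul_apply]

lemma conjTranspose_col_mul_col (u : EuclideanSpace ℂ (Fin p)) :
    (col u)ᴴ * col u = ((‖u‖ ^ 2 : ℝ) : ℂ) • (1 : Matrix Unit Unit ℂ) := by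
  ext i j
  simp only [col, Matrix.mul_apply, conjTranspose_apply, of_apply, EuclideanSpace.norm_sq_eq,
    Matrix.smul_apply, Complex.ofReal_sum]
  simp [← Complex.normSq_eq_norm_sq, Complex.normSq_eq_conj_mul_self]

lemma outer_mul_outer (a b c : EuclideanSpace ℂ (Fin p)) :
    outer a b * outer b c = ((‖b‖ ^ 2 : ℝ) : ℂ) • outer a c := by
  rw [← col_mul_conjTranspose_col, ← col_mul_conjTranspose_col, Matrix.mul_assoc,
    ← Matrix.mul_assoc (col b)ᴴ, conjTranspose_col_mul_col, ← col_mul_conjTranspose_col]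
  simp

lemma conjTranspose_outer (a b : EuclideanSpace ℂ (Fin p)) : (outer a b)ᴴ = outer b a := by
  rw [← col_mul_conjTranspose_col, ← col_mul_conjTranspose_col, conjTranspose_mul,
    conjTranspose_conjTranspose]

lemma sub_smul_outer_mul (x : EuclideanSpace ℂ (Fin p)) (c d : ℂ) :
    (1 - c • outer x x) * (1 - d • outer x x) =
      1 - (c + d - c * d * ((‖x‖ ^ 2 : ℝ) : ℂ)) • outer x x := by
  simp only [mul_sub, sub_mul, mul_one, one_mul, smul_mul_assoc, mul_smul_comm, outer_mul_outer]
  module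

/-- A square root of `1 - t x x*`. -/
lemma sq_sub_smul_outer (x : EuclideanSpace ℂ (Fin p)) {t s : ℝ} (hs : 0 ≤ s)
    (h : s ^ 2 = 1 - t * ‖x‖ ^ 2) :
    (1 - ((t / (1 + s) : ℝ) : ℂ) • outer x x) * (1 - ((t / (1 + s) : ℝ) : ℂ) • outer x x) =
      1 - (t : ℂ) • outer x x := by
  rw [sub_smul_outer_mul]
  congr 2
  norm_cast
  have : 1 + s ≠ 0 := by positivity
  field_simp
  linear_combination -t * h

lemma posSemidef_sub_smul_outer (x : EuclideanSpace ℂ (Fin p)) {t : ℝ}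
    (h : t * ‖x‖ ^ 2 ≤ 1) : (1 - (t : ℂ) • outer x x).PosSemidef := by
  rw [← sq_sub_smul_outer x (Real.sqrt_nonneg (1 - t * ‖x‖ ^ 2)) (Real.sq_sqrt (by linarith))]
  set c : ℝ := t / (1 + √(1 - t * ‖x‖ ^ 2))
  have hh : (1 - (c : ℂ) • outer x x)ᴴ = 1 - (c : ℂ) • outer x x := by
    simp [conjTranspose_sub, conjTranspose_smul, conjTranspose_outer]
  nth_rewrite 1 [← hh]
  exact posSemidef_conjTranspose_mul_self _

/-- The positive square root acts as `s` on the line of `x` and trivially on its complement. The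
coefficient `t / (1 + s)`, in place of `(1 - s) / ‖x‖²`, keeps the formula valid for `x = 0`. -/
lemma invSqrt_sub_smul_outer (x : EuclideanSpace ℂ (Fin p)) {t s : ℝ} (hs : 0 < s)
    (h : s ^ 2 = 1 - t * ‖x‖ ^ 2) :
    invSqrt (1 - (t : ℂ) • outer x x) = 1 + ((t / (s * (1 + s)) : ℝ) : ℂ) • outer x x := by
  have h1 : 1 + s ≠ 0 := by positivity
  have hn : t / (1 + s) * ‖x‖ ^ 2 = 1 - s := by
    field_simp; linear_combination h
  have hsq : CFC.sqrt (1 - (t : ℂ) • outer x x) = 1 - ((t / (1 + s) : ℝ) : ℂ) • outer x x := by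
    refine CFC.sqrt_unique (sq_sub_smul_outer x hs.le h) ?_
    rw [Matrix.nonneg_iff_posSemidef]
    exact posSemidef_sub_smul_outer x (by linarith)
  rw [invSqrt, hsq]
  refine Matrix.inv_eq_right_inv ?_
  have := sub_smul_outer_mul x ((t / (1 + s) : ℝ) : ℂ) (-((t / (s * (1 + s)) : ℝ) : ℂ))
  rw [neg_smul, sub_neg_eq_add] at this
  rw [this]
  have h0 : (((t / (1 + s) : ℝ) : ℂ) + -((t / (s * (1 + s)) : ℝ) : ℂ) -
      ((t / (1 + s) : ℝ) : ℂ) * -((t / (s * (1 + s)) : ℝ) : ℂ) * ((‖x‖ ^ 2 : ℝ) : ℂ)) = 0 := by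
    norm_cast
    field_simp
    linear_combination t * h
  rw [h0, zero_smul, sub_zero]

end Outer

/-! ### Halmos extensions of rank one contractions -/

section Halmos

variable {p : ℕ}

/-- The Halmos extension of the rank one matrix `ε u v*`, with `h = (1 - |ε|² ‖v‖²)^{-1/2}`. -/
lemma halmos_smul_outer {u v : EuclideanSpace ℂ (Fin p)} (hu : ‖u‖ = 1) (ε : ℂ) {h : ℝ}
    (h0 : 0 < h) (hh : h ^ 2 * (1 - ‖ε‖ ^ 2 * ‖v‖ ^ 2) = 1) :
    halmos (ε • outer u v) =
      fromBlocks (1 + (h - 1 : ℂ) • outer u u) ((h * ε) • outer u v)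
        ((h * star ε) • outer v u)
        (1 + (((‖ε‖ ^ 2 * h ^ 2 / (1 + h) : ℝ)) : ℂ) • outer v v) := by
  have hεε : ε * star ε = ((‖ε‖ ^ 2 : ℝ) : ℂ) := by
    rw [← Complex.normSq_eq_norm_sq, ← Complex.mul_conj]; rfl
  have hsq : (h⁻¹) ^ 2 = 1 - ‖ε‖ ^ 2 * ‖v‖ ^ 2 := by
    field_simp; linear_combination -hh
  have h1 : 1 + h ≠ 0 := by positivity
  have e1 : (ε • outer u v) * (ε • outer u v)ᴴ
      = ((‖ε‖ ^ 2 * ‖v‖ ^ 2 : ℝ) : ℂ) • outer u u := by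
    rw [conjTranspose_smul, conjTranspose_outer, smul_mul_smul_comm, outer_mul_outer, hεε,
      smul_smul, ← Complex.ofReal_mul]
  have e2 : (ε • outer u v)ᴴ * (ε • outer u v) = ((‖ε‖ ^ 2 : ℝ) : ℂ) • outer v v := by
    rw [conjTranspose_smul, conjTranspose_outer, smul_mul_smul_comm, outer_mul_outer,
      mul_comm (star ε), hεε, hu]
    simp
  have i1 : invSqrt (1 - (ε • outer u v) * (ε • outer u v)ᴴ) = 1 + (h - 1 : ℂ) • outer u u := by
    rw [e1, invSqrt_sub_smul_outer u (inv_pos.2 h0) (by rw [hsq, hu]; ring)]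
    congr 2
    norm_cast
    field_simp
    linear_combination -hh
  have i2 : invSqrt (1 - (ε • outer u v)ᴴ * (ε • outer u v)) =
      1 + (((‖ε‖ ^ 2 * h ^ 2 / (1 + h) : ℝ)) : ℂ) • outer v v := by
    rw [e2, invSqrt_sub_smul_outer v (inv_pos.2 h0) hsq]
    congr 3
    field_simp
    ring
  rw [halmos, i1, i2]
  congr 1
  · rw [mul_add, mul_one, smul_mul_smul_comm, outer_mul_outer, smul_smul, ← add_smul]
    congr 1
    have : (((‖ε‖ ^ 2 * h ^ 2 / (1 + h) : ℝ)) : ℂ) * ((‖v‖ ^ 2 : ℝ) : ℂ) = h - 1 := by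
      norm_cast
      field_simp
      linear_combination -hh
    linear_combination ε * this
  · rw [conjTranspose_smul, conjTranspose_outer, mul_add, mul_one, smul_mul_smul_comm,
      outer_mul_outer, hu, smul_smul, ← add_smul]
    congr 1
    push_cast
    ring

/-- The Halmos extension of a strict contraction of rank one is `J`-unitary. -/
lemma halmos_smul_outer_J {u v : EuclideanSpace ℂ (Fin p)} (hu : ‖u‖ = 1) (ε : ℂ) 
    (hv : ‖ε‖ ^ 2 * ‖v‖ ^ 2 < 1) :
    (halmos (ε • outer u v))ᴴ * J p * halmos (ε • outer u v) = J p := by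
  have hpos : 0 < 1 - ‖ε‖ ^ 2 * ‖v‖ ^ 2 := by linarith
  have hh : (1 / √(1 - ‖ε‖ ^ 2 * ‖v‖ ^ 2)) ^ 2 * (1 - ‖ε‖ ^ 2 * ‖v‖ ^ 2) = 1 := by
    rw [div_pow, Real.sq_sqrt hpos.le]; field_simp
  have h0 : 0 < 1 / √(1 - ‖ε‖ ^ 2 * ‖v‖ ^ 2) := by positivity
  rw [halmos_smul_outer hu ε h0 hh]
  generalize 1 / √(1 - ‖ε‖ ^ 2 * ‖v‖ ^ 2) = h at hh h0
  have hεε : ε * star ε = ((‖ε‖ ^ 2 : ℝ) : ℂ) := by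
    rw [← Complex.normSq_eq_norm_sq, ← Complex.mul_conj]; rfl
  have h1 : 1 + h ≠ 0 := by positivity
  set μ : ℝ := ‖ε‖ ^ 2 * h ^ 2 / (1 + h) with hμ
  have hμ1 : (μ : ℂ) * (1 + h) = ((‖ε‖ ^ 2 : ℝ) : ℂ) * h ^ 2 := by
    norm_cast; rw [hμ]; field_simp
  have hμn : (μ : ℂ) * ((‖v‖ ^ 2 : ℝ) : ℂ) = h - 1 := by
    norm_cast; rw [hμ]; field_simp; linear_combination -hh
  have hhc : (h : ℂ) ^ 2 * (1 - ((‖ε‖ ^ 2 : ℝ) : ℂ) * ((‖v‖ ^ 2 : ℝ) : ℂ)) = 1 := by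
    norm_cast
  have hu2 : ((‖u‖ ^ 2 : ℝ) : ℂ) = 1 := by simp [hu]
  rw [J, fromBlocks_conjTranspose, fromBlocks_multiply, fromBlocks_multiply]
  simp only [conjTranspose_add, conjTranspose_smul, conjTranspose_one, conjTranspose_outer,
    star_mul', star_sub, star_one, Complex.star_def, Complex.conj_ofReal, Complex.conj_conj, mul_one,
    mul_zero, add_zero, zero_add, mul_neg, neg_mul, mul_add, add_mul, one_mul, smul_mul_assoc,
    mul_smul_comm, outer_mul_outer, hu2, one_smul]
  simp only [Complex.star_def] at hεε
  generalize ((‖v‖ ^ 2 : ℝ) : ℂ) = n at *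
  generalize ((‖ε‖ ^ 2 : ℝ) : ℂ) = r at *
  generalize (starRingEnd ℂ) ε = ε' at *
  congr 1 <;> match_scalars <;> try ring1
  · linear_combination hhc - h ^ 2 * n * hεε
  · linear_combination -h * ε * hμn
  · linear_combination -h * ε' * hμn
  · linear_combination h ^ 2 * hεε - hμ1 - μ * hμn

end Halmos

/-! ### The blocks of `Θ̂` -/

section ThetaHat

variable {p : ℕ}

/-- The product `H(u v*) diag(I - (1 - β) u u*, I) H(w̄ u v*)`, computed from the multiplication
table of `P = u u*`, `R = u v*`, `Q = v u*`, `N = v v*`. -/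
lemma halmos_mul_diag_mul_halmos {K m : Type} [Field K] [Fintype m] [DecidableEq m]
    {P R Q N : Matrix m m K} {n a b α δ w w' β : K}
    (hPP : P * P = P) (hPR : P * R = R) (hQP : Q * P = Q) (hQR : Q * R = N)
    (hRQ : R * Q = n • P) (hRN : R * N = n • R) (hNQ : N * Q = n • Q) (hNN : N * N = n • N)
    (hα : α * n = a - 1) (hδ : δ * n = b - 1) :
    fromBlocks (1 + (a - 1) • P) (a • R) (a • Q) (1 + α • N) *
        fromBlocks (1 - (1 - β) • P) 0 0 1 *
        fromBlocks (1 + (b - 1) • P) ((b * w') • R) ((b * w) • Q) (1 + δ • N) =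
      fromBlocks (1 + (a * b * (β + w * n) - 1) • P) ((a * b * (w' * β + 1)) • R)
        ((a * b * (β + w)) • Q) (1 + (a * b * w' * β + (α + δ + α * δ * n)) • N) := by
  rw [fromBlocks_multiply, fromBlocks_multiply]
  simp only [mul_one, mul_zero, add_zero, zero_add, mul_add, add_mul, one_mul, smul_mul_assoc,
    mul_sub, sub_mul, mul_smul_comm, hPP, hPR, hQP, hQR, hRQ, hRN, hNQ, hNN]
  congr 1 <;> match_scalars <;> try ring1
  · linear_combination a * hδ
  · linear_combination b * w * hα

/-- The product of the constant rational matrices `a b*` and `b c*`. -/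
lemma const_outer_mul_outer (a b c : EuclideanSpace ℂ (Fin p)) :
    const (outer a b) * const (outer b c) =
      RatFunc.C ((‖b‖ ^ 2 : ℝ) : ℂ) • const (outer a c) := by
  rw [← const_mul, outer_mul_outer, const_smul]

/-- The blocks of `Θ̂(u,v,w)`. -/
lemma thetaHat_eq {u v : EuclideanSpace ℂ (Fin p)} (hu : ‖u‖ = 1) (w : ℂ) {a b : ℝ}
    (a0 : 0 < a) (b0 : 0 < b) (ha : a ^ 2 * (1 - ‖v‖ ^ 2) = 1)
    (hb : b ^ 2 * (1 - ‖w‖ ^ 2 * ‖v‖ ^ 2) = 1) :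
    ∃ μ : ℂ, μ * ((‖v‖ ^ 2 : ℝ) : ℂ) = a * b - 1 ∧
      thetaHat u v w = fromBlocks
        (1 + (RatFunc.C (a * b : ℂ) *
          (blaschke w + RatFunc.C (w * ((‖v‖ ^ 2 : ℝ) : ℂ))) - 1) • const (outer u u))
        ((RatFunc.C (a * b : ℂ) * (RatFunc.C (star w) * blaschke w + 1)) • const (outer u v))
        ((RatFunc.C (a * b : ℂ) * (blaschke w + RatFunc.C w)) • const (outer v u))
        (1 + (RatFunc.C (a * b * star w : ℂ) * blaschke w + RatFunc.C μ) •
          const (outer v v)) := by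
  have hww : w * star w = ((‖w‖ ^ 2 : ℝ) : ℂ) := by
    rw [← Complex.normSq_eq_norm_sq, ← Complex.mul_conj]; rfl
  have ha1 : 1 + a ≠ 0 := by positivity
  have hb1 : 1 + b ≠ 0 := by positivity
  have e1 := halmos_smul_outer (v := v) hu 1 a0 (by simpa using ha)
  have e2 := halmos_smul_outer (v := v) hu (star w) b0 (by rw [norm_star]; exact hb)
  rw [one_smul] at e1
  simp only [star_star, norm_star] at e2
  set α : ℝ := ‖(1 : ℂ)‖ ^ 2 * a ^ 2 / (1 + a) with hα
  set δ : ℝ := ‖w‖ ^ 2 * b ^ 2 / (1 + b) with hδ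
  have hαn : (α : ℂ) * ((‖v‖ ^ 2 : ℝ) : ℂ) = a - 1 := by
    norm_cast; rw [hα]; simp only [norm_one]; field_simp; linear_combination -ha
  have hδn : (δ : ℂ) * ((‖v‖ ^ 2 : ℝ) : ℂ) = b - 1 := by
    norm_cast; rw [hδ]; field_simp; linear_combination -hb
  -- This constant multiplies `vv*`, so only its product with `‖v‖²` is recorded; no division by
  -- `‖v‖` is needed.
  refine ⟨α + δ + α * δ * ((‖v‖ ^ 2 : ℝ) : ℂ), by
    linear_combination (1 + (δ : ℂ) * ((‖v‖ ^ 2 : ℝ) : ℂ)) * hαn + a * hδn, ?_⟩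
  have hu2 : ((‖u‖ ^ 2 : ℝ) : ℂ) = 1 := by simp [hu]
  have hαC := congrArg (RatFunc.C (K := ℂ)) hαn
  have hδC := congrArg (RatFunc.C (K := ℂ)) hδn
  rw [thetaHat, e1, e2, S, const_fromBlocks, const_fromBlocks]
  simp only [const_add, const_smul, const_one, star_one, map_mul, map_one, map_sub, map_add,
    mul_one] at hαC hδC ⊢
  have o1 := const_outer_mul_outer u u u
  rw [hu2, map_one, one_smul] at o1
  have o2 := const_outer_mul_outer v u u
  rw [hu2, map_one, one_smul] at o2
  have o3 := const_outer_mul_outer v u v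
  rw [hu2, map_one, one_smul] at o3
  have o4 := const_outer_mul_outer u u v
  rw [hu2, map_one, one_smul] at o4
  exact halmos_mul_diag_mul_halmos o1 o4 o2 o3 (const_outer_mul_outer u v u)
    (const_outer_mul_outer u v v) (const_outer_mul_outer v v u) (const_outer_mul_outer v v v)
    hαC hδC

end ThetaHat

/-! ### Abstract identities behind the equality of the two transformations -/

section Algebra

variable {K A : Type} [Field K] [Ring A] [Algebra K A] {P R Q N G : A} {g : K}

/-- Inverting a rank one perturbation of the identity. -/
lemma rankOne_perturbation_mul_inv {k q : K} (hPP : P * P = P) (hPR : P * R = R)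
    (hP : R * (G * P) = g • P) (hR : ∀ X, R * (G * (R * X)) = g • (R * X)) (hd : k + q * g ≠ 0) :
    (q • (R * G) + (1 + (k - 1) • P)) *
      (1 - (k + q * g)⁻¹ • ((k - 1) • P + q • (R * G))) = 1 := by
  have hPR' : ∀ X, P * (R * X) = R * X := fun X => by rw [← mul_assoc, hPR]
  simp only [mul_one, mul_add, add_mul, one_mul, smul_mul_assoc, mul_sub, mul_smul_comm, mul_assoc,
    hPP, hPR', hP, hR]
  match_scalars <;> field_simp <;> ring

/-- The linear fractional form and the feedback form of the same transformation, multiplied by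
their denominators. -/
lemma feedback_mul_eq {c w w' s z q κ m k : K} (hPP : P * P = P) (hPR : P * R = R)
    (hQP : Q * P = Q) (hQR : Q * R = N)
    (hRP : R * (G * P) = g • P) (hRR : ∀ X, R * (G * (R * X)) = g • (R * X))
    (hc : c ≠ 0) (h1 : s + w * w' * c ^ 2 = 1) (h2 : c * q * (1 - w' * z) = s)
    (hk : k = z * q - w * c) (hm : m • N = (q - κ) • N) :
    ((z - (w * c ^ 2 - s * g)) • (s • Q + (1 - κ • N) * G * (1 - (1 + w' * c) • P)) +
      ((s * w * c ^ 2) • Q - (s * w * c) • (N * G * (1 - (1 + w' * c) • P)) +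
        (s * c) • ((1 - κ • N) * (G * P)) -
        s • ((1 - κ • N) * (G * (R * (G * (1 - (1 + w' * c) • P))))))) *
      (q • (R * G) + (1 + (k - 1) • P)) =
    (z - (w * c ^ 2 - s * g)) • ((1 + m • N) * G + (z * q) • Q) := by
  have hPR' : ∀ X, P * (R * X) = R * X := fun X => by rw [← mul_assoc, hPR]
  have hQR' : ∀ X, Q * (R * X) = N * X := fun X => by rw [← mul_assoc, hQR]
  have hNP : N * (G * P) = g • Q := by
    rw [← hQR, mul_assoc, hRP, mul_smul_comm, hQP]
  have hNR : ∀ X, N * (G * (R * X)) = g • (N * X) := fun X => by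
    rw [← hQR, mul_assoc, hRR, mul_smul_comm, ← mul_assoc]
  have hm' : m • (N * G) = (q - κ) • (N * G) := by
    rw [← smul_mul_assoc, hm, smul_mul_assoc]
  subst hk
  -- The right side is the feedback denominator at `g = 0`; together with `h2` this ties it to `k`.
  have I2 : (c * (z * q - w * c)) * (1 - w' * z) = z - w * c ^ 2 := by
    linear_combination z * h2 + z * h1
  have I3 : s = 1 - w * w' * c ^ 2 := by linear_combination h1
  simp only [mul_one, mul_add, add_mul, one_mul, smul_mul_assoc, mul_sub, sub_mul, mul_smul_comm,
    mul_assoc, hPP, hPR', hQR', hQP, hRP, hRR, hNP, hNR, hm']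
  match_scalars <;> try ring1
  · linear_combination (q * s * g + q * z) * h1 + w * c * h2 - κ * g * (c * q * h1 + h2)
  · linear_combination c * q * h1 + h2
  · refine mul_left_cancel₀ hc ?_
    linear_combination s * g * (c * (z * q - w * c)) * h1 +
      z * (-(c * (z * q - w * c)) * h2 + c * q * I2) -
      c * κ * g * (I2 + (c * (z * q - w * c)) * h1)
  · linear_combination I2 + (c * (z * q - w * c)) * h1

end Algebra

/-! ### The blocks of `F = V diag(1, G) U*` for `Û`, `V̂` -/

section Feedback
variable {p : ℕ}

lemma Fmat_fromBlocks (U₁ V₁ : Matrix (Fin p) Unit ℂ) (U₂ V₂ : Matrix (Fin p) (Fin p) ℂ)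
    (U₃ V₃ : Matrix Unit Unit ℂ) (U₄ V₄ : Matrix Unit (Fin p) ℂ) (G : RatMat (Fin p) (Fin p)) :
    Fmat (fromBlocks U₁ U₂ U₃ U₄) (fromBlocks V₁ V₂ V₃ V₄) G =
      fromBlocks (const V₁ * const U₁ᴴ + const V₂ * G * const U₂ᴴ)
        (const V₁ * const U₃ᴴ + const V₂ * G * const U₄ᴴ)
        (const V₃ * const U₁ᴴ + const V₄ * G * const U₂ᴴ)
        (const V₃ * const U₃ᴴ + const V₄ * G * const U₄ᴴ) := by
  rw [Fmat, fromBlocks_conjTranspose, const_fromBlocks, const_fromBlocks, fromBlocks_multiply,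
    fromBlocks_multiply]
  simp

/-- The scalar function `v* G u`. -/
def bilin (u v : EuclideanSpace ℂ (Fin p)) (G : RatMat (Fin p) (Fin p)) : RatFunc ℂ :=
  (const (col v)ᴴ * G * const (col u)) () ()

lemma bilin_smul_one (u v : EuclideanSpace ℂ (Fin p)) (G : RatMat (Fin p) (Fin p)) :
    const (col v)ᴴ * G * const (col u) = bilin u v G • (1 : RatMat Unit Unit) := by
  ext i j; simp [bilin]

lemma const_outer_mul_mul_const_outer (x u v y : EuclideanSpace ℂ (Fin p))
    (G : RatMat (Fin p) (Fin p)) :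
    const (outer x v) * (G * const (outer u y)) = bilin u v G • const (outer x y) := by
  rw [← col_mul_conjTranspose_col, ← col_mul_conjTranspose_col x y,
    ← col_mul_conjTranspose_col u y, const_mul, const_mul, const_mul]
  have := bilin_smul_one u v G
  calc _ = const (col x) * (const (col v)ᴴ * G * const (col u)) * const (col y)ᴴ := by
        simp only [Matrix.mul_assoc]
    _ = _ := by rw [this]; simp

lemma of_const_eq_smul_one (c : ℂ) : (Matrix.of fun _ _ => c : Matrix Unit Unit ℂ) = c • 1 := by
  ext i j; simp

lemma star_cA (v : EuclideanSpace ℂ (Fin p)) (w : ℂ) : star (cA v w) = cA v w :=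
  Complex.conj_ofReal _

lemma star_cK (v : EuclideanSpace ℂ (Fin p)) (w : ℂ) : star (cK v w) = cK v w :=
  Complex.conj_ofReal _

lemma Fmat_hat (u v : EuclideanSpace ℂ (Fin p)) (w : ℂ) (G : RatMat (Fin p) (Fin p)) :
    Fmat (Uhat u v w) (Vhat v w) G = fromBlocks
      (RatFunc.C (cA v w ^ 2) • const (outer v u) +
        (1 - RatFunc.C ((1 - cK v w) / ((‖v‖ ^ 2 : ℝ) : ℂ)) • const (outer v v)) * G *
          (1 - RatFunc.C (1 + star w * cK v w) • const (outer u u)))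
      (RatFunc.C (cA v w * w * cK v w) • const (col v) + RatFunc.C (cA v w) •
        ((1 - RatFunc.C ((1 - cK v w) / ((‖v‖ ^ 2 : ℝ) : ℂ)) • const (outer v v)) *
          (G * const (col u))))
      (RatFunc.C (cA v w * cK v w) • const (col u)ᴴ - RatFunc.C (cA v w) •
        (const (col v)ᴴ * (G * (1 - RatFunc.C (1 + star w * cK v w) • const (outer u u)))))
      (RatFunc.C (w * cK v w ^ 2) • 1 - RatFunc.C (cA v w ^ 2) •
        (const (col v)ᴴ * G * const (col u))) := by
  rw [Uhat, Vhat, Fmat_fromBlocks, of_const_eq_smul_one, of_const_eq_smul_one]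
  simp only [conjTranspose_smul, conjTranspose_sub, conjTranspose_one, conjTranspose_outer,
    star_cA, conjTranspose_conjTranspose, const_smul, const_sub, const_neg, const_one,
    star_mul', star_add, star_one, star_star, star_cK]
  simp only [Matrix.smul_mul, Matrix.mul_smul, Matrix.mul_one, Matrix.one_mul, Matrix.neg_mul,
    smul_smul, Matrix.mul_assoc, ← const_mul, col_mul_conjTranspose_col, map_mul, map_pow]
  congr 1
  · rw [← pow_two]
  · congr 2
    ring
  · rw [← sub_eq_add_neg]
  · rw [sub_eq_add_neg, smul_neg, smul_smul, ← pow_two]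
    congr 2
    ring

end Feedback

/-! ### Equality of the linear fractional and feedback forms -/

section Main
variable {p : ℕ}

/-- Here `a` and `b` are the normalizing constants of `H(uv*)` and `H(w̄uv*)`. In terms of them the
radicals of `Û`, `V̂` obey polynomial relations, which later algebra uses instead of square roots.
-/
lemma exists_normalizations {v : EuclideanSpace ℂ (Fin p)} {w : ℂ} (hv : ‖v‖ < 1)
    (hw : ‖w‖ < 1) :
    ∃ a b : ℝ, 0 < a ∧ 0 < b ∧ a ^ 2 * (1 - ‖v‖ ^ 2) = 1 ∧
      b ^ 2 * (1 - ‖w‖ ^ 2 * ‖v‖ ^ 2) = 1 ∧ cK v w * a = b ∧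
      cA v w ^ 2 = (((1 - ‖w‖ ^ 2) * b ^ 2 : ℝ) : ℂ) := by
  have hv1 : 0 < 1 - ‖v‖ ^ 2 := by nlinarith [norm_nonneg v]
  have hw1 : 0 < 1 - ‖w‖ ^ 2 := by nlinarith [norm_nonneg w]
  have h1 : 0 < 1 - ‖w‖ ^ 2 * ‖v‖ ^ 2 := by nlinarith [sq_nonneg ‖w‖, sq_nonneg ‖v‖]
  refine ⟨1 / √(1 - ‖v‖ ^ 2), 1 / √(1 - ‖w‖ ^ 2 * ‖v‖ ^ 2), by positivity, by positivity,
    ?_, ?_, ?_, ?_⟩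
  · rw [div_pow, Real.sq_sqrt hv1.le]; field_simp
  · rw [div_pow, Real.sq_sqrt h1.le]; field_simp
  · rw [cK]
    norm_cast
    field_simp
  · rw [cA]
    norm_cast
    rw [div_pow, div_pow, Real.sq_sqrt h1.le, Real.sq_sqrt hw1.le]
    field_simp

lemma one_sub_C_mul_X_ne_zero (c : ℂ) : (1 - RatFunc.C c * RatFunc.X : RatFunc ℂ) ≠ 0 := by
  intro h
  have h2 : (1 - Polynomial.C c * Polynomial.X : Polynomial ℂ) = 0 := by
    apply RatFunc.algebraMap_injective ℂ
    simpa [RatFunc.algebraMap_C, RatFunc.algebraMap_X] using h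
  have := congrArg (Polynomial.eval 0) h2
  simp at this

lemma star_mul_self_eq_norm_sq (w : ℂ) : w * star w = ((‖w‖ ^ 2 : ℝ) : ℂ) := by
  rw [← Complex.normSq_eq_norm_sq, ← Complex.mul_conj]; rfl

lemma Fden_hat (u v : EuclideanSpace ℂ (Fin p)) (w : ℂ) (G : RatMat (Fin p) (Fin p)) :
    Fden (Uhat u v w) (Vhat v w) G = RatFunc.X -
      (RatFunc.C w * RatFunc.C (cK v w) ^ 2 - RatFunc.C (cA v w ^ 2) * bilin u v G) := by
  rw [Fden, Fmat_hat, toBlocks_fromBlocks₂₂, bilin_smul_one]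
  simp

lemma smul_combination_eq {K M : Type} [Field K] [AddCommGroup M] [Module K M] (α w c : K)
    (x y z t : M) :
    (α * c) • ((α * w * c) • x + α • y) - α • ((α * w * c) • z + α • t) =
      (α ^ 2 * w * c ^ 2) • x - (α ^ 2 * w * c) • z + (α ^ 2 * c) • y - α ^ 2 • t := by
  module

/-- Each factor of `F₂F₃` carries one `α`, so only `α²` survives, and columns meet rows to form rank
one matrices. The result has the shape used in `feedback_mul_eq`. -/
lemma hat_off_diagonal_mul (u v : EuclideanSpace ℂ (Fin p)) (α w c : ℂ)
    (V G U : RatMat (Fin p) (Fin p)) :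
    (RatFunc.C (α * w * c) • const (col v) + RatFunc.C α • (V * (G * const (col u)))) *
      (RatFunc.C (α * c) • const (col u)ᴴ - RatFunc.C α • (const (col v)ᴴ * (G * U))) =
    (RatFunc.C (α ^ 2) * RatFunc.C w * RatFunc.C c ^ 2) • const (outer v u) -
      (RatFunc.C (α ^ 2) * RatFunc.C w * RatFunc.C c) • (const (outer v v) * G * U) +
      (RatFunc.C (α ^ 2) * RatFunc.C c) • (V * (G * const (outer u u))) -
      RatFunc.C (α ^ 2) • (V * (G * (const (outer u v) * (G * U)))) := by
  simp only [← col_mul_conjTranspose_col, const_mul, Matrix.mul_assoc, Matrix.add_mul,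
    Matrix.mul_sub, Matrix.smul_mul, Matrix.mul_smul, map_mul, map_pow]
  exact smul_combination_eq _ _ _ _ _ _ _

/-- `T_Θ̂(G) = F_{Û,V̂}(G)` wherever the right-hand side is defined. -/
theorem lft_thetaHat_eq_FUV {u v : EuclideanSpace ℂ (Fin p)} {w : ℂ} (hu : ‖u‖ = 1)
    (hv : ‖v‖ < 1) (hw : ‖w‖ < 1) {G : RatMat (Fin p) (Fin p)}
    (hG : Fden (Uhat u v w) (Vhat v w) G ≠ 0) :
    InDomain (thetaHat u v w) G ∧
      lft (thetaHat u v w) G = FUV (Uhat u v w) (Vhat v w) G := by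
  obtain ⟨a, b, a0, b0, ha, hb, hK, hA⟩ := exists_normalizations hv hw
  obtain ⟨μ, hμ, hΘ⟩ := thetaHat_eq (v := v) hu w a0 b0 ha hb
  have hu2 : ((‖u‖ ^ 2 : ℝ) : ℂ) = 1 := by simp [hu]
  have hPP : const (outer u u) * const (outer u u) = const (outer u u) := by
    rw [const_outer_mul_outer, hu2, map_one, one_smul]
  have hPR : const (outer u u) * const (outer u v) = const (outer u v) := by
    rw [const_outer_mul_outer, hu2, map_one, one_smul]
  have hQP : const (outer v u) * const (outer u u) = const (outer v u) := by
    rw [const_outer_mul_outer, hu2, map_one, one_smul]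
  have hQR : const (outer v u) * const (outer u v) = const (outer v v) := by
    rw [const_outer_mul_outer, hu2, map_one, one_smul]
  have hRP := const_outer_mul_mul_const_outer u u v u G
  have hRR : ∀ X : RatMat (Fin p) (Fin p), const (outer u v) * (G * (const (outer u v) * X)) =
      bilin u v G • (const (outer u v) * X) := fun X => by
    rw [← mul_assoc G, ← mul_assoc, const_outer_mul_mul_const_outer, smul_mul_assoc]
  have hac : (a : ℂ) ≠ 0 := by exact_mod_cast a0.ne'
  have hbc : (b : ℂ) ≠ 0 := by exact_mod_cast b0.ne'
  have hac2 : (a : ℂ) ^ 2 * (1 - ((‖v‖ ^ 2 : ℝ) : ℂ)) = 1 := by exact_mod_cast ha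
  have hbc2 : (b : ℂ) ^ 2 * (1 - ((‖w‖ ^ 2 : ℝ) : ℂ) * ((‖v‖ ^ 2 : ℝ) : ℂ)) = 1 := by
    exact_mod_cast hb
  have hc0 : cK v w ≠ 0 := by
    intro h; rw [h, zero_mul] at hK; exact hbc hK.symm
  have hww := star_mul_self_eq_norm_sq w
  have hAr : cA v w ^ 2 = (1 - ((‖w‖ ^ 2 : ℝ) : ℂ)) * b ^ 2 := by rw [hA]; push_cast; ring
  have hs0 : cA v w ^ 2 ≠ 0 := by
    rw [hA]; norm_cast
    have : 0 < 1 - ‖w‖ ^ 2 := by nlinarith [norm_nonneg w]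
    positivity
  have h1c : cA v w ^ 2 + w * star w * cK v w ^ 2 = 1 := by
    refine mul_right_cancel₀ (pow_ne_zero 2 hac) ?_
    linear_combination (a ^ 2 : ℂ) * hAr + (cK v w ^ 2 * a ^ 2) * hww +
      ((‖w‖ ^ 2 : ℝ) : ℂ) * (cK v w * a + b) * hK + (a : ℂ) ^ 2 * hbc2 -
      (b : ℂ) ^ 2 * ((‖w‖ ^ 2 : ℝ) : ℂ) * hac2
  have h1 := congrArg (RatFunc.C (K := ℂ)) h1c
  set β := blaschke w with hβ
  have hden := one_sub_C_mul_X_ne_zero (star w)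
  have hβz : β * (1 - RatFunc.C (star w) * RatFunc.X) = RatFunc.X - RatFunc.C w := by
    rw [hβ, blaschke, div_mul_cancel₀ _ hden]
  set q : RatFunc ℂ := RatFunc.C (a * b : ℂ) * (RatFunc.C (star w) * β + 1) with hq
  have hβw : β + RatFunc.C w = RatFunc.X * (RatFunc.C (star w) * β + 1) := by
    linear_combination hβz
  have hcab : cK v w * (a * b) = b ^ 2 := by linear_combination (b : ℂ) * hK
  have h2 : RatFunc.C (cK v w) * q * (1 - RatFunc.C (star w) * RatFunc.X) =
      RatFunc.C (cA v w ^ 2) := by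
    rw [hAr, ← hww, hq]
    have := congrArg (RatFunc.C (K := ℂ)) hcab
    simp only [map_mul, map_sub, map_one, map_pow] at this ⊢
    linear_combination (RatFunc.C (star w) * β + 1) * (1 - RatFunc.C (star w) * RatFunc.X) * this +
      RatFunc.C (b : ℂ) ^ 2 * RatFunc.C (star w) * hβz
  have habn : (a : ℂ) * b * (1 - ((‖v‖ ^ 2 : ℝ) : ℂ)) = cK v w := by
    refine mul_right_cancel₀ hac ?_
    linear_combination (b : ℂ) * hac2 - hK
  have hk : RatFunc.C (a * b : ℂ) * (β + RatFunc.C (w * ((‖v‖ ^ 2 : ℝ) : ℂ))) =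
      RatFunc.X * q - RatFunc.C w * RatFunc.C (cK v w) := by
    rw [← habn, hq]
    simp only [map_mul, map_sub, map_one]
    linear_combination RatFunc.C (a : ℂ) * RatFunc.C (b : ℂ) * hβw
  -- Equality of the coefficients themselves is not available at `v = 0`, where the quotient by
  -- `‖v‖²` is a default value; after multiplication by `vv*` both sides are then zero.
  have hm : (RatFunc.C (a * b * star w : ℂ) * β + RatFunc.C μ) • const (outer v v) =
      (q - RatFunc.C ((1 - cK v w) / ((‖v‖ ^ 2 : ℝ) : ℂ))) • const (outer v v) := by
    by_cases hv0 : v = 0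
    · have : outer v v = 0 := by ext i j; simp [outer, hv0]
      rw [this]; simp
    · congr 1
      have hn : ((‖v‖ ^ 2 : ℝ) : ℂ) ≠ 0 := by
        norm_cast
        exact pow_ne_zero 2 (norm_ne_zero_iff.2 hv0)
      have : μ = a * b - (1 - cK v w) / ((‖v‖ ^ 2 : ℝ) : ℂ) := by
        rw [eq_sub_iff_add_eq, ← eq_sub_iff_add_eq', div_eq_iff hn]
        linear_combination hμ + habn
      rw [this, hq]
      simp only [map_mul, map_sub]
      ring
  set g := bilin u v G with hg
  set s := cA v w ^ 2 with hs
  have hδ := Fden_hat u v w G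
  have hq0 : q ≠ 0 := by
    intro h
    rw [h, mul_zero, zero_mul] at h2
    exact hs0 (RatFunc.C_injective (by rw [← h2, map_zero]))
  set k := RatFunc.C (a * b : ℂ) * (β + RatFunc.C (w * ((‖v‖ ^ 2 : ℝ) : ℂ))) with hkdef
  simp only [map_add, map_mul, map_one, map_pow] at h1
  have hd : k + q * g ≠ 0 := by
    -- The two denominators are proportional, with nonzero factors `s` and `q`; this is why both
    -- maps are defined together.
    have : RatFunc.C s * (k + q * g) = q * Fden (Uhat u v w) (Vhat v w) G := by
      rw [hδ, hk]
      linear_combination RatFunc.C w * RatFunc.C (cK v w) * h2 + RatFunc.X * q * h1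
    intro h0
    rw [h0, mul_zero] at this
    exact mul_ne_zero hq0 hG this.symm
  have hinv := rankOne_perturbation_mul_inv hPP hPR hRP hRR hd
  have hcore := feedback_mul_eq (c := RatFunc.C (cK v w)) hPP hPR hQP hQR hRP hRR
    (by simpa using hc0) h1 h2 hk hm
  rw [← hδ] at hcore
  have hunit : IsUnit (q • (const (outer u v) * G) + (1 + (k - 1) • const (outer u u))) :=
    IsUnit.of_mul_eq_one _ hinv
  have hdom : (thetaHat u v w).toBlocks₁₂ * G + (thetaHat u v w).toBlocks₁₁ =
      q • (const (outer u v) * G) + (1 + (k - 1) • const (outer u u)) := by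
    rw [hΘ, toBlocks_fromBlocks₁₂, toBlocks_fromBlocks₁₁, smul_mul_assoc]
  refine ⟨by rw [InDomain, hdom]; exact hunit, ?_⟩
  have hF : FUV (Uhat u v w) (Vhat v w) G *
      (q • (const (outer u v) * G) + (1 + (k - 1) • const (outer u u))) =
      (thetaHat u v w).toBlocks₂₂ * G + (thetaHat u v w).toBlocks₂₁ := by
    rw [hΘ, toBlocks_fromBlocks₂₂, toBlocks_fromBlocks₂₁, hβw, mul_left_comm, ← hq]
    refine smul_right_injective _ hG ?_
    beta_reduce
    rw [← hcore, ← smul_mul_assoc, FUV, smul_add, smul_inv_smul₀ hG, Fmat_hat,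
      toBlocks_fromBlocks₁₁, toBlocks_fromBlocks₁₂, toBlocks_fromBlocks₂₁, hat_off_diagonal_mul]
    simp only [map_mul, map_add, map_one, map_pow, hs]
  rw [lft, hdom, ← hF, Matrix.mul_assoc,
    Matrix.mul_nonsing_inv _ ((Matrix.isUnit_iff_isUnit_det _).1 hunit), Matrix.mul_one]

end Main

/-! ### Values of rational functions at regular points -/

section Regular

/-- `f` is regular at `z` with value `c`. -/
def RegAt (f : RatFunc ℂ) (z c : ℂ) : Prop :=
  f.denom.eval z ≠ 0 ∧ f.eval (RingHom.id ℂ) z = c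

lemma regAt_C (c z : ℂ) : RegAt (RatFunc.C c) z c := by
  simp [RegAt, RatFunc.eval_C]

lemma regAt_X (z : ℂ) : RegAt RatFunc.X z z := by
  simp [RegAt, RatFunc.eval_X]

lemma RegAt.add {f g : RatFunc ℂ} {z c d : ℂ} (hf : RegAt f z c) (hg : RegAt g z d) :
    RegAt (f + g) z (c + d) := by
  refine ⟨fun h => ?_, ?_⟩
  · have := Polynomial.eval_eq_zero_of_dvd_of_eval_eq_zero (RatFunc.denom_add_dvd f g) h
    rw [Polynomial.eval_mul] at this
    exact mul_ne_zero hf.1 hg.1 this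
  · rw [RatFunc.eval_add _ _ hf.1 hg.1, hf.2, hg.2]

lemma RegAt.mul {f g : RatFunc ℂ} {z c d : ℂ} (hf : RegAt f z c) (hg : RegAt g z d) :
    RegAt (f * g) z (c * d) := by
  refine ⟨fun h => ?_, ?_⟩
  · have := Polynomial.eval_eq_zero_of_dvd_of_eval_eq_zero (RatFunc.denom_mul_dvd f g) h
    rw [Polynomial.eval_mul] at this
    exact mul_ne_zero hf.1 hg.1 this
  · rw [RatFunc.eval_mul _ _ hf.1 hg.1, hf.2, hg.2]

lemma RegAt.neg {f : RatFunc ℂ} {z c : ℂ} (hf : RegAt f z c) : RegAt (-f) z (-c) := by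
  have := (regAt_C (-1) z).mul hf
  simpa using this

lemma RegAt.sub {f g : RatFunc ℂ} {z c d : ℂ} (hf : RegAt f z c) (hg : RegAt g z d) :
    RegAt (f - g) z (c - d) := by
  rw [sub_eq_add_neg, sub_eq_add_neg]; exact hf.add hg.neg

lemma RegAt.sum {ι : Type} (s : Finset ι) {f : ι → RatFunc ℂ} {z : ℂ} {c : ι → ℂ}
    (h : ∀ i, RegAt (f i) z (c i)) : RegAt (∑ i ∈ s, f i) z (∑ i ∈ s, c i) := by
  classical
  induction s using Finset.induction_on with
  | empty => simpa using regAt_C 0 z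
  | insert i s hi ih => rw [Finset.sum_insert hi, Finset.sum_insert hi]; exact (h i).add ih

lemma RegAt.unique {f : RatFunc ℂ} {z c d : ℂ} (hf : RegAt f z c) (hg : RegAt f z d) : c = d :=
  hf.2.symm.trans hg.2

/-- The denominator of `f⁻¹` divides the numerator of `f`, which is nonzero at `z` because `c` is;
the value then follows from `f f⁻¹ = 1`. -/
lemma regAt_inv {f : RatFunc ℂ} {z c : ℂ} (hf : RegAt f z c) (hc : c ≠ 0) :
    RegAt f⁻¹ z c⁻¹ := by
  have hf0 : f ≠ 0 := by
    rintro rfl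
    exact hc (hf.unique (by simpa using regAt_C 0 z))
  have hn : f.num.eval z ≠ 0 := by
    intro h
    apply hc
    rw [← hf.2, RatFunc.eval]
    change f.num.eval z / _ = 0
    rw [h, zero_div]
  have h1 : f⁻¹.denom.eval z ≠ 0 := fun h =>
    hn (Polynomial.eval_eq_zero_of_dvd_of_eval_eq_zero (RatFunc.denom_inv_dvd hf0) h)
  refine ⟨h1, ?_⟩
  have h2 : RegAt f⁻¹ z (f⁻¹.eval (RingHom.id ℂ) z) := ⟨h1, rfl⟩
  have h3 := hf.mul h2
  rw [mul_inv_cancel₀ hf0] at h3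
  have h4 := h3.unique (by simpa using regAt_C 1 z)
  exact eq_inv_of_mul_eq_one_right h4

variable {l m n : Type}

/-- The rational matrix `R` is analytic at `z` with value `M`. -/
def MatRegAt (R : RatMat m n) (z : ℂ) (M : Matrix m n ℂ) : Prop :=
  ∀ i j, RegAt (R i j) z (M i j)

lemma MatRegAt.analyticAtPt {R : RatMat m n} {z : ℂ} {M : Matrix m n ℂ} (h : MatRegAt R z M) :
    AnalyticAtPt R z := fun i j => (h i j).1

lemma MatRegAt.evalAt_eq {R : RatMat m n} {z : ℂ} {M : Matrix m n ℂ} (h : MatRegAt R z M) :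
    evalAt R z = M := by
  ext i j; exact (h i j).2

lemma AnalyticAtPt.matRegAt {R : RatMat m n} {z : ℂ} (h : AnalyticAtPt R z) :
    MatRegAt R z (evalAt R z) := fun i j => ⟨h i j, rfl⟩

lemma matRegAt_const (M : Matrix m n ℂ) (z : ℂ) : MatRegAt (const M) z M :=
  fun _ _ => regAt_C _ _

lemma MatRegAt.mul [Fintype m] {R : RatMat l m} {T : RatMat m n} {z : ℂ} {M : Matrix l m ℂ}
    {N : Matrix m n ℂ} (hR : MatRegAt R z M) (hT : MatRegAt T z N) :
    MatRegAt (R * T) z (M * N) := fun i j => by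
  simp only [Matrix.mul_apply]
  exact RegAt.sum _ fun k => (hR i k).mul (hT k j)

lemma MatRegAt.add {R T : RatMat m n} {z : ℂ} {M N : Matrix m n ℂ}
    (hR : MatRegAt R z M) (hT : MatRegAt T z N) : MatRegAt (R + T) z (M + N) :=
  fun i j => (hR i j).add (hT i j)

lemma MatRegAt.smul {R : RatMat m n} {z c : ℂ} {f : RatFunc ℂ} {M : Matrix m n ℂ}
    (hf : RegAt f z c) (hR : MatRegAt R z M) : MatRegAt (f • R) z (c • M) :=
  fun i j => hf.mul (hR i j)

/-- A rational matrix function is analytic at some point of the unit circle. -/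
lemma exists_analyticAtPt_circle [Fintype m] [Fintype n] (R : RatMat m n) :
    ∃ z : ℂ, ‖z‖ = 1 ∧ AnalyticAtPt R z := by
  classical
  set D : Polynomial ℂ := ∏ i, ∏ j, (R i j).denom with hD
  have hD0 : D ≠ 0 := Finset.prod_ne_zero_iff.2 fun i _ =>
    Finset.prod_ne_zero_iff.2 fun j _ => RatFunc.denom_ne_zero _
  -- A connected set with two points is infinite, whereas the product of the denominators has
  -- finitely many roots.
  have hinf : (Metric.sphere (0 : ℂ) 1).Infinite := by
    have h := isPreconnected_sphere (E := ℂ) (by rw [Complex.rank_real_complex]; norm_num) 0 1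
    exact h.infinite_of_nontrivial ⟨1, by simp, -1, by simp, by norm_num⟩
  obtain ⟨z, hz, hz2⟩ := hinf.exists_notMem_finset D.roots.toFinset
  refine ⟨z, by simpa using hz, fun i j h => hz2 ?_⟩
  rw [Multiset.mem_toFinset, Polynomial.mem_roots hD0, Polynomial.IsRoot.def, hD]
  simp only [Polynomial.eval_prod]
  exact Finset.prod_eq_zero (Finset.mem_univ i) (Finset.prod_eq_zero (Finset.mem_univ j) h)

end Regular
-- Nonvanishing of the feedback denominator
section Bound
variable {p : ℕ}

/-- Cauchy–Schwarz for `v` and `Mu`, where `M` is an isometry. -/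
lemma norm_conjTranspose_col_mul_mul_col_le {M : Matrix (Fin p) (Fin p) ℂ} (hM : Mᴴ * M = 1)
    (u v : EuclideanSpace ℂ (Fin p)) :
    ‖((col v)ᴴ * M * col u) () ()‖ ≤ ‖v‖ * ‖u‖ := by
  set y : EuclideanSpace ℂ (Fin p) := WithLp.toLp 2 (M *ᵥ u.ofLp) with hy
  have hcol : col y = M * col u := by
    ext i j; simp [col, hy, Matrix.mul_apply, Matrix.mulVec, dotProduct]
  have hny : ‖y‖ = ‖u‖ := by
    have h1 := conjTranspose_col_mul_col y
    rw [hcol, conjTranspose_mul, Matrix.mul_assoc, ← Matrix.mul_assoc Mᴴ, hM, Matrix.one_mul,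
      conjTranspose_col_mul_col] at h1
    have h2 := congrFun (congrFun h1 ()) ()
    simp only [Matrix.smul_apply, one_apply_eq, smul_eq_mul, mul_one] at h2
    have h3 : ‖u‖ ^ 2 = ‖y‖ ^ 2 := by exact_mod_cast h2
    exact ((pow_left_inj₀ (norm_nonneg _) (norm_nonneg _) two_ne_zero).1 h3).symm
  have : ((col v)ᴴ * M * col u) () () = inner ℂ v y := by
    rw [Matrix.mul_assoc, ← hcol]
    simp [col, Matrix.mul_apply, PiLp.inner_apply, mul_comm]
  rw [this, ← hny]
  exact norm_inner_le_norm v y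

/-- `G` is analytic with a unitary value at some point of the unit circle. -/
def UnitaryOnCircle (G : RatMat (Fin p) (Fin p)) : Prop :=
  ∃ z M, ‖z‖ = 1 ∧ MatRegAt G z M ∧ Mᴴ * M = 1

/-- A single such point is all that part (b) needs from losslessness. -/
lemma IsLossless.unitaryOnCircle {G : RatMat (Fin p) (Fin p)} (hG : IsLossless G) :
    UnitaryOnCircle G := by
  obtain ⟨z, hz, hreg⟩ := exists_analyticAtPt_circle G
  refine ⟨z, _, hz, hreg.matRegAt, ?_⟩
  simpa using (hG z hreg).2.1 hz

/-- Unitary constants are the test functions used for part (a). -/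
lemma isLossless_const {G : Matrix (Fin p) (Fin p) ℂ} (hG : Gᴴ * G = 1) :
    IsLossless (const G) := by
  intro z _
  rw [(matRegAt_const G z).evalAt_eq]
  simp [hG, PosSemidef.zero]

lemma UnitaryOnCircle.mul {G : RatMat (Fin p) (Fin p)} (hG : UnitaryOnCircle G)
    {P Q : Matrix (Fin p) (Fin p) ℂ} (hP : P * Pᴴ = 1) (hQ : Qᴴ * Q = 1) :
    UnitaryOnCircle (const Q * G * const Pᴴ) := by
  obtain ⟨z, M, hz, hreg, hM⟩ := hG
  refine ⟨z, Q * M * Pᴴ, hz, ((matRegAt_const Q z).mul hreg).mul (matRegAt_const _ z), ?_⟩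
  calc (Q * M * Pᴴ)ᴴ * (Q * M * Pᴴ) = P * (Mᴴ * (Qᴴ * Q) * M) * Pᴴ := by
        simp only [conjTranspose_mul, conjTranspose_conjTranspose, Matrix.mul_assoc]
    _ = 1 := by rw [hQ, Matrix.mul_one, hM, Matrix.mul_one, hP]

/-- The difference of the two sides is `b²(1 - rs)(1 - r)(1 - s)`. With `r = |w|` and `s = ‖v‖` the
left side bounds `|F₄|` on the circle. -/
lemma blaschke_bound {r s b : ℝ} (hr0 : 0 ≤ r) (hr : r < 1) (hs : s < 1)
    (hb : b ^ 2 * (1 - r ^ 2 * s ^ 2) = 1) :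
    r * ((1 - s ^ 2) * b ^ 2) + (1 - r ^ 2) * b ^ 2 * s < 1 := by
  have hrs : r * s < 1 := by nlinarith
  have : 0 < (1 - r * s) * ((1 - r) * (1 - s)) :=
    mul_pos (by linarith) (mul_pos (by linarith) (by linarith))
  have hb0 : 0 < b ^ 2 := by
    have : b ≠ 0 := by rintro rfl; norm_num at hb
    positivity
  nlinarith [mul_pos hb0 this]

/-- If `F₄` were the function `z`, its value at the given point of the circle would have modulus
one, but there `|v*Gu| ≤ ‖v‖` keeps `|F₄|` below one. -/
lemma UnitaryOnCircle.Fden_ne_zero {G : RatMat (Fin p) (Fin p)} (hG : UnitaryOnCircle G)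
    {u v : EuclideanSpace ℂ (Fin p)} {w : ℂ} (hu : ‖u‖ = 1) (hv : ‖v‖ < 1) (hw : ‖w‖ < 1) :
    Fden (Uhat u v w) (Vhat v w) G ≠ 0 := by
  obtain ⟨a, b, a0, b0, ha, hb, hK, hA⟩ := exists_normalizations hv hw
  obtain ⟨z, M, hz, hreg, hM⟩ := hG
  have hg : RegAt (bilin u v G) z (((col v)ᴴ * M * col u) () ()) :=
    ((matRegAt_const _ z).mul hreg).mul (matRegAt_const _ z) () ()
  have hgn := norm_conjTranspose_col_mul_mul_col_le hM u v
  rw [hu, mul_one] at hgn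
  intro h
  rw [Fden_hat, sub_eq_zero, ← map_pow, ← map_mul] at h
  have hz2 := (regAt_X z).unique (h ▸ (regAt_C _ z).sub ((regAt_C _ z).mul hg))
  have hK2 : cK v w ^ 2 = (((1 - ‖v‖ ^ 2) * b ^ 2 : ℝ) : ℂ) := by
    have hK' : (cK v w * a) ^ 2 = (b : ℂ) ^ 2 := by rw [hK]
    have hac2 : (a : ℂ) ^ 2 * (1 - (‖v‖ : ℂ) ^ 2) = 1 := by exact_mod_cast ha
    push_cast
    linear_combination (1 - (‖v‖ : ℂ) ^ 2) * hK' - cK v w ^ 2 * hac2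
  have h1 : 0 ≤ (1 - ‖v‖ ^ 2) * b ^ 2 :=
    mul_nonneg (by nlinarith [norm_nonneg v]) (sq_nonneg b)
  have h2 : 0 ≤ (1 - ‖w‖ ^ 2) * b ^ 2 :=
    mul_nonneg (by nlinarith [norm_nonneg w]) (sq_nonneg b)
  have := blaschke_bound (norm_nonneg w) hw hv hb
  have h3 : ‖z‖ ≤ ‖w‖ * ((1 - ‖v‖ ^ 2) * b ^ 2) + (1 - ‖w‖ ^ 2) * b ^ 2 * ‖v‖ := by
    rw [hz2]
    refine (norm_sub_le _ _).trans ?_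
    rw [norm_mul, norm_mul, hK2, hA, Complex.norm_of_nonneg h1, Complex.norm_of_nonneg h2]
    gcongr
  linarith

end Bound

/-! ### Unitarity of `Û`, `V̂` and the factors `diag(1, P)`, `diag(1, Q)` -/

section Hat
variable {p : ℕ}

lemma norm_sq_mul_outer_eq_zero {v : EuclideanSpace ℂ (Fin p)} {c : ℂ}
    (h : c * ((‖v‖ ^ 2 : ℝ) : ℂ) = 0) : c • outer v v = 0 := by
  rcases mul_eq_zero.1 h with h | h
  · rw [h, zero_smul]
  · have : v = 0 := by
      have h' : ‖v‖ ^ 2 = 0 := by exact_mod_cast h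
      simpa using h'
    ext i j; simp [this, outer]

/-- This survives `v = 0`: division by zero gives `0`, and `cK` equals `1` there. -/
lemma one_sub_cK_div_mul (v : EuclideanSpace ℂ (Fin p)) (w : ℂ) :
    (1 - cK v w) / ((‖v‖ ^ 2 : ℝ) : ℂ) * ((‖v‖ ^ 2 : ℝ) : ℂ) = 1 - cK v w := by
  by_cases hv : v = 0
  · simp [hv, cK]
  · rw [div_mul_cancel₀]
    norm_cast
    exact pow_ne_zero 2 (norm_ne_zero_iff.2 hv)

/-- These say that the first columns of `V̂` and (for `‖u‖ = 1`) of `Û` are unit vectors. -/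
lemma cA_sq_mul_add (v : EuclideanSpace ℂ (Fin p)) {w : ℂ} (hv : ‖v‖ < 1) (hw : ‖w‖ < 1) :
    cA v w ^ 2 * ((‖v‖ ^ 2 : ℝ) : ℂ) + cK v w ^ 2 = 1 ∧
      cA v w ^ 2 + w * star w * cK v w ^ 2 = 1 := by
  have hv1 : 0 < 1 - ‖v‖ ^ 2 := by nlinarith [norm_nonneg v]
  have hw1 : 0 < 1 - ‖w‖ ^ 2 := by nlinarith [norm_nonneg w]
  have h1 : 0 < 1 - ‖w‖ ^ 2 * ‖v‖ ^ 2 := by nlinarith [sq_nonneg ‖w‖, sq_nonneg ‖v‖]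
  rw [star_mul_self_eq_norm_sq, cA, cK]
  constructor <;>
  · norm_cast
    rw [div_pow, div_pow, Real.sq_sqrt h1.le, Real.sq_sqrt hw1.le, Real.sq_sqrt hv1.le]
    field_simp
    ring

lemma isUnitary_of_conjTranspose_mul {U : BlockMat p} (h : Uᴴ * U = 1) : IsUnitary U :=
  ⟨(Matrix.mul_eq_one_comm_of_card_eq _ _ _ (by simp [add_comm])).1 h, h⟩

lemma isUnitary_Uhat {u v : EuclideanSpace ℂ (Fin p)} {w : ℂ} (hu : ‖u‖ = 1) (hv : ‖v‖ < 1)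
    (hw : ‖w‖ < 1) : IsUnitary (Uhat u v w) := by
  apply isUnitary_of_conjTranspose_mul
  have h := (cA_sq_mul_add v hv hw).2
  have hu2 : ((‖u‖ ^ 2 : ℝ) : ℂ) = 1 := by simp [hu]
  have huu : (col u)ᴴ * col u = 1 := by rw [conjTranspose_col_mul_col, hu2, one_smul]
  have hPP : outer u u * outer u u = outer u u := by rw [outer_mul_outer, hu2, one_smul]
  have hcP : (col u)ᴴ * outer u u = (col u)ᴴ := by
    rw [← col_mul_conjTranspose_col, ← Matrix.mul_assoc, huu, Matrix.one_mul]
  have hPc : outer u u * col u = col u := by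
    rw [← col_mul_conjTranspose_col, Matrix.mul_assoc, huu, Matrix.mul_one]
  rw [Uhat, of_const_eq_smul_one, fromBlocks_conjTranspose, fromBlocks_multiply,
    ← fromBlocks_one]
  simp only [conjTranspose_smul, conjTranspose_sub, conjTranspose_one, conjTranspose_outer,
    star_cA, conjTranspose_conjTranspose, star_mul', star_add, star_one, star_star, star_cK,
    Matrix.smul_mul, Matrix.mul_smul, Matrix.mul_one, Matrix.one_mul, Matrix.mul_sub,
    Matrix.sub_mul, huu, hPP, hcP, hPc, col_mul_conjTranspose_col]
  congr 1 <;> match_scalars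
  all_goals first | ring1 | linear_combination h

lemma isUnitary_Vhat {v : EuclideanSpace ℂ (Fin p)} {w : ℂ} (hv : ‖v‖ < 1)
    (hw : ‖w‖ < 1) : IsUnitary (Vhat v w) := by
  apply isUnitary_of_conjTranspose_mul
  have h := (cA_sq_mul_add v hv hw).1
  have hκ := one_sub_cK_div_mul v w
  have hcP : (col v)ᴴ * outer v v = ((‖v‖ ^ 2 : ℝ) : ℂ) • (col v)ᴴ := by
    rw [← col_mul_conjTranspose_col, ← Matrix.mul_assoc, conjTranspose_col_mul_col,
      Matrix.smul_mul, Matrix.one_mul]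
  have hPc : outer v v * col v = ((‖v‖ ^ 2 : ℝ) : ℂ) • col v := by
    rw [← col_mul_conjTranspose_col, Matrix.mul_assoc, conjTranspose_col_mul_col,
      Matrix.mul_smul, Matrix.mul_one]
  have hκs : star ((1 - cK v w) / ((‖v‖ ^ 2 : ℝ) : ℂ)) = (1 - cK v w) / ((‖v‖ ^ 2 : ℝ) : ℂ) := by
    rw [star_div₀, star_sub, star_one, star_cK]; congr 1; exact Complex.conj_ofReal _
  rw [Vhat, of_const_eq_smul_one, fromBlocks_conjTranspose, fromBlocks_multiply,
    ← fromBlocks_one]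
  simp only [conjTranspose_smul, conjTranspose_sub, conjTranspose_one, conjTranspose_outer,
    star_cA, conjTranspose_conjTranspose, star_cK,
    Matrix.smul_mul, Matrix.mul_smul, Matrix.mul_one, Matrix.one_mul, Matrix.mul_sub,
    Matrix.sub_mul, conjTranspose_col_mul_col, outer_mul_outer, hcP, hPc,
    col_mul_conjTranspose_col, hκs, conjTranspose_neg, Matrix.mul_neg, Matrix.neg_mul]
  generalize (1 - cK v w) / ((‖v‖ ^ 2 : ℝ) : ℂ) = κ at *
  congr 1
  · generalize ((‖v‖ ^ 2 : ℝ) : ℂ) = n at *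
    match_scalars; linear_combination h
  · generalize ((‖v‖ ^ 2 : ℝ) : ℂ) = n at *
    match_scalars; linear_combination -cA v w * hκ
  · generalize ((‖v‖ ^ 2 : ℝ) : ℂ) = n at *
    match_scalars; linear_combination -cA v w * hκ
  -- The coefficient of `vv*` is only known to vanish after multiplication by `‖v‖²`, which
  -- suffices.
  · have := norm_sq_mul_outer_eq_zero (v := v)
      (c := -κ - κ + κ * κ * ((‖v‖ ^ 2 : ℝ) : ℂ) + cA v w ^ 2) (by
        linear_combination h + (κ * ((‖v‖ ^ 2 : ℝ) : ℂ) - 1 - cK v w) * hκ)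
    rw [← sub_eq_zero, ← this]
    module

lemma IsUnitary.mul_diagOne {U : BlockMat p} (hU : IsUnitary U) {P : Matrix (Fin p) (Fin p) ℂ}
    (hP : Pᴴ * P = 1) : IsUnitary (U * diagOne P) := by
  apply isUnitary_of_conjTranspose_mul
  rw [conjTranspose_mul, Matrix.mul_assoc, ← Matrix.mul_assoc Uᴴ, hU.2, Matrix.one_mul, diagOne,
    fromBlocks_conjTranspose, fromBlocks_multiply, ← fromBlocks_one]
  simp [hP]

/-- For unitary `P` the substitution `G ↦ QGP*` is also the linear fractional transformation of
`diag(P, Q)`. -/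
lemma Fmat_mul_diagOne (U V : BlockMat p) (P Q : Matrix (Fin p) (Fin p) ℂ)
    (G : RatMat (Fin p) (Fin p)) :
    Fmat (U * diagOne P) (V * diagOne Q) G = Fmat U V (const Q * G * const Pᴴ) := by
  have h : const (diagOne Q) * (fromBlocks 1 0 0 G : RatMat (Unit ⊕ Fin p) (Unit ⊕ Fin p)) *
      const (diagOne P)ᴴ = fromBlocks 1 0 0 (const Q * G * const Pᴴ) := by
    rw [diagOne, diagOne, fromBlocks_conjTranspose, const_fromBlocks, const_fromBlocks,
      fromBlocks_multiply, fromBlocks_multiply]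
    simp
  rw [Fmat, Fmat, ← h, conjTranspose_mul, const_mul, const_mul]
  simp only [Matrix.mul_assoc]

end Hat

/-! ### Composition of linear fractional transformations -/

section Substitution
variable {p : ℕ}

/-- Composition of linear fractional transformations. -/
lemma inDomain_mul_and_lft_mul (T M : RatMat (Fin p ⊕ Fin p) (Fin p ⊕ Fin p))
    {G G' : RatMat (Fin p) (Fin p)} (hdom : InDomain M G)
    (hG' : M.toBlocks₂₂ * G + M.toBlocks₂₁ = G' * (M.toBlocks₁₂ * G + M.toBlocks₁₁)) :
    (InDomain (T * M) G ↔ InDomain T G') ∧ lft (T * M) G = lft T G' := by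
  set K := M.toBlocks₁₂ * G + M.toBlocks₁₁ with hK
  rw [InDomain, ← hK] at hdom
  have hT : T * M = fromBlocks (T.toBlocks₁₁ * M.toBlocks₁₁ + T.toBlocks₁₂ * M.toBlocks₂₁)
      (T.toBlocks₁₁ * M.toBlocks₁₂ + T.toBlocks₁₂ * M.toBlocks₂₂)
      (T.toBlocks₂₁ * M.toBlocks₁₁ + T.toBlocks₂₂ * M.toBlocks₂₁)
      (T.toBlocks₂₁ * M.toBlocks₁₂ + T.toBlocks₂₂ * M.toBlocks₂₂) := by
    rw [← fromBlocks_multiply, fromBlocks_toBlocks, fromBlocks_toBlocks]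
  have h1 : (T * M).toBlocks₁₂ * G + (T * M).toBlocks₁₁ =
      (T.toBlocks₁₂ * G' + T.toBlocks₁₁) * K := by
    rw [hT, toBlocks_fromBlocks₁₂, toBlocks_fromBlocks₁₁, add_mul _ _ K, mul_assoc _ G', ← hG', hK]
    noncomm_ring
  have h2 : (T * M).toBlocks₂₂ * G + (T * M).toBlocks₂₁ =
      (T.toBlocks₂₂ * G' + T.toBlocks₂₁) * K := by
    rw [hT, toBlocks_fromBlocks₂₂, toBlocks_fromBlocks₂₁, add_mul _ _ K, mul_assoc _ G', ← hG', hK]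
    noncomm_ring
  refine ⟨?_, ?_⟩
  · rw [InDomain, InDomain, h1]
    exact hdom.mul_right_iff
  · rw [lft, lft, h1, h2, Matrix.mul_inv_rev, Matrix.mul_assoc, ← Matrix.mul_assoc K,
      Matrix.mul_nonsing_inv _ ((Matrix.isUnit_iff_isUnit_det _).1 hdom), Matrix.one_mul]

end Substitution

/-! ### Proof of part (b) -/

section PartB
variable {p : ℕ}

theorem coincideOnLossless_hat {u v : EuclideanSpace ℂ (Fin p)} {w : ℂ}
    {P Q : Matrix (Fin p) (Fin p) ℂ} (hu : ‖u‖ = 1) (hv : ‖v‖ < 1) (hw : ‖w‖ < 1)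
    (hP : P ∈ Matrix.unitaryGroup (Fin p) ℂ) (hQ : Q ∈ Matrix.unitaryGroup (Fin p) ℂ) :
    CoincideOnLossless (thetaHat u v w * const (diagPQ P Q)) (Uhat u v w * diagOne P)
      (Vhat v w * diagOne Q) := by
  intro G hG
  have hP1 : P * Pᴴ = 1 := Matrix.mem_unitaryGroup_iff.1 hP
  have hP2 : Pᴴ * P = 1 := Matrix.mem_unitaryGroup_iff'.1 hP
  have hQ2 : Qᴴ * Q = 1 := Matrix.mem_unitaryGroup_iff'.1 hQ
  have hne := (hG.unitaryOnCircle.mul hP1 hQ2).Fden_ne_zero hu hv hw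
  obtain ⟨hdom, hlft⟩ := lft_thetaHat_eq_FUV hu hv hw hne
  have hcP : const P * const Pᴴ = 1 := by rw [← const_mul, hP1, const_one]
  have hcP2 : const Pᴴ * const P = 1 := by rw [← const_mul, hP2, const_one]
  obtain ⟨h1, h2⟩ := inDomain_mul_and_lft_mul (thetaHat u v w) (const (diagPQ P Q)) (G := G)
    (G' := const Q * G * const Pᴴ)
    (by rw [InDomain, diagPQ, const_fromBlocks]; simpa using IsUnit.of_mul_eq_one _ hcP)
    (by rw [diagPQ, const_fromBlocks]; simp [mul_assoc, hcP2])
  have hF := Fmat_mul_diagOne (Uhat u v w) (Vhat v w) P Q G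
  refine ⟨h1.2 hdom, ?_, ?_⟩
  · rwa [Fden, hF]
  · rw [h2, hlft, FUV, FUV, Fden, Fden, hF]

end PartB

/-! ### Functions of McMillan degree one -/

section Realization

variable {m n : Type}

lemma norm_star_mul_lt {w z : ℂ} (hw : ‖w‖ < 1) (hz : ‖z‖ ≤ 1) : ‖star w * z‖ < 1 := by
  rw [norm_mul, norm_star]
  nlinarith [norm_nonneg w, norm_nonneg z]

/-- The value of the Blaschke factor. -/
lemma regAt_blaschke {w z : ℂ} (hw : ‖w‖ < 1) (hz : ‖z‖ ≤ 1) :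
    RegAt (blaschke w) z ((z - w) / (1 - star w * z)) := by
  rw [blaschke, div_eq_mul_inv, div_eq_mul_inv]
  refine ((regAt_X z).sub (regAt_C w z)).mul (regAt_inv ?_ ?_)
  · have := (regAt_C 1 z).sub ((regAt_C (star w) z).mul (regAt_X z))
    rwa [map_one] at this
  · intro h
    have := norm_star_mul_lt hw hz
    rw [← sub_eq_zero.1 h, norm_one] at this
    exact lt_irrefl _ this

/-- The Blaschke factor maps the unit circle onto itself. -/
lemma exists_regAt_blaschke {w l : ℂ} (hw : ‖w‖ < 1) (hl : ‖l‖ = 1) :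
    ∃ z : ℂ, ‖z‖ = 1 ∧ RegAt (blaschke w) z l := by
  have h1 : 1 + star w * l ≠ 0 := by
    intro h
    have := norm_star_mul_lt hw hl.le
    rw [← norm_neg, ← eq_neg_of_add_eq_zero_left h, norm_one] at this
    exact lt_irrefl _ this
  have hll : l * star l = 1 := by rw [star_mul_self_eq_norm_sq, hl]; simp
  have hz : ‖(l + w) / (1 + star w * l)‖ = 1 := by
    have : l + w = l * star (1 + star w * l) := by
      rw [star_add, star_one, star_mul', star_star]
      linear_combination -w * hll
    rw [this, norm_div, norm_mul, norm_star, hl, one_mul, div_self]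
    exact norm_ne_zero_iff.2 h1
  refine ⟨_, hz, ?_⟩
  have h2 : 1 - star w * ((l + w) / (1 + star w * l)) ≠ 0 := by
    intro h
    have := norm_star_mul_lt hw hz.le
    rw [← sub_eq_zero.1 h, norm_one] at this
    exact lt_irrefl _ this
  convert regAt_blaschke hw hz.le using 1
  rw [eq_div_iff h2]
  have hx := div_mul_cancel₀ (l + w) h1
  linear_combination -hx

lemma hasRealization_const (D : Matrix m n ℂ) : HasRealization (const D) 0 0 := by
  refine ⟨D, 0, 0, 0, 0, 0, 0, ⟨1, by simp⟩, ?_⟩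
  simp

lemma X_sub_C_ne_zero (α : ℂ) : (RatFunc.X - RatFunc.C α : RatFunc ℂ) ≠ 0 := by
  intro h0
  have h := (regAt_X (α + 1)).unique (by rw [sub_eq_zero.1 h0]; exact regAt_C α (α + 1))
  simp at h

lemma not_regAt_inv_X_sub_C (α c : ℂ) : ¬ RegAt (RatFunc.X - RatFunc.C α)⁻¹ α c := by
  intro h
  have h1 := ((regAt_X α).sub (regAt_C α α)).mul h
  rw [mul_inv_cancel₀ (X_sub_C_ne_zero α), sub_self, zero_mul] at h1
  exact one_ne_zero ((by simpa using regAt_C 1 α : RegAt (1 : RatFunc ℂ) α 1).unique h1)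

/-- The Blaschke factor with zero at the reflection `w = 1/ᾱ` has its only pole at `α`, so `1/(z -
α)` is affine in it. -/
lemma inv_X_sub_C_eq {α : ℂ} (hα : 1 < ‖α‖) :
    (RatFunc.X - RatFunc.C α : RatFunc ℂ)⁻¹ =
      RatFunc.C (-(α - star α⁻¹)⁻¹) +
        blaschke (star α⁻¹) * RatFunc.C (-(α * (α - star α⁻¹))⁻¹) := by
  have hα0 : α ≠ 0 := by rintro rfl; norm_num at hα
  have hαw : α - star α⁻¹ ≠ 0 := by
    intro h
    have h1 := congrArg norm (sub_eq_zero.1 h)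
    rw [norm_star, norm_inv] at h1
    have : ‖α‖⁻¹ < 1 := inv_lt_one_of_one_lt₀ hα
    linarith
  have hden := one_sub_C_mul_X_ne_zero α⁻¹
  have hα0' : RatFunc.C α ≠ 0 := by simpa using hα0
  have hαw' : RatFunc.C α - RatFunc.C (star α⁻¹) ≠ 0 := by
    rw [← map_sub]; exact (map_ne_zero _).2 hαw
  have hX := X_sub_C_ne_zero α
  rw [blaschke, star_star]
  generalize star α⁻¹ = w at *
  simp only [map_neg, map_inv₀, map_mul, map_sub] at hden ⊢
  have hX' : (RatFunc.C α - RatFunc.X : RatFunc ℂ) ≠ 0 := by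
    rw [← neg_sub]; exact neg_ne_zero.2 hX
  have : (1 - (RatFunc.C α)⁻¹ * RatFunc.X : RatFunc ℂ) =
      (RatFunc.C α - RatFunc.X) / RatFunc.C α := by field_simp
  rw [this]
  field_simp
  ring

/-- A function of McMillan degree one, analytic on the closed unit disk, is a function of degree
one of a Blaschke factor. -/
lemma exists_eq_const_add_blaschke_smul {R : RatMat m n} (hdeg : mcMillanDegree R = 1)
    (han : ∀ z : ℂ, ‖z‖ ≤ 1 → AnalyticAtPt R z) :
    ∃ (w : ℂ) (K : Matrix m n ℂ) (c : Matrix m Unit ℂ) (r : Matrix Unit n ℂ), ‖w‖ < 1 ∧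
      c * r ≠ 0 ∧ R = const K + blaschke w • const (c * r) := by
  have hne := Nat.nonempty_of_sInf_eq_succ hdeg
  have hmem := Nat.sInf_mem hne
  -- Degree zero is excluded; this is what makes the residue, or the coefficient of `z`, nonzero
  -- below.
  have h0 : ¬ HasRealization R 0 0 := fun h =>
    Nat.notMem_of_lt_sInf (m := 0) (lt_of_lt_of_eq zero_lt_one hdeg.symm) ⟨0, 0, rfl, h⟩
  rw [show sInf _ = 1 from hdeg] at hmem
  obtain ⟨n₁, n₂, hn, D, A, B, C, N, B', C', hN, hR⟩ := hmem
  have hcase : (n₁ = 1 ∧ n₂ = 0) ∨ (n₁ = 0 ∧ n₂ = 1) := by omega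
  have key : ∀ (C : Matrix m (Fin 1) ℂ) (B : Matrix (Fin 1) n ℂ),
      C.submatrix id (fun _ : Unit => 0) * B.submatrix (fun _ : Unit => 0) id = C * B := by
    intro C B
    ext i j
    simp [Matrix.mul_apply]
  rcases hcase with ⟨rfl, rfl⟩ | ⟨rfl, rfl⟩
  · have hinv : ((RatFunc.X : RatFunc ℂ) • (1 : RatMat (Fin 1) (Fin 1)) - const A)⁻¹ =
        (RatFunc.X - RatFunc.C (A 0 0))⁻¹ • 1 := by
      have : (RatFunc.X : RatFunc ℂ) • (1 : RatMat (Fin 1) (Fin 1)) - const A =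
          (RatFunc.X - RatFunc.C (A 0 0)) • 1 := by
        ext i j
        fin_cases i; fin_cases j
        simp [const]
      rw [this]
      refine Matrix.inv_eq_right_inv ?_
      rw [smul_mul_smul_comm, mul_one, mul_inv_cancel₀ (X_sub_C_ne_zero _), one_smul]
    have hR' : R = const D + (RatFunc.X - RatFunc.C (A 0 0))⁻¹ • const (C * B) := by
      rw [hR, hinv, const_mul]
      ext i j
      simp [Matrix.mul_apply]
    have hCB : C * B ≠ 0 := by
      intro h
      apply h0
      rw [hR', h, const_zero, smul_zero, add_zero]
      exact hasRealization_const D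
    generalize A 0 0 = α at *
    -- A nonzero entry of `CB` makes `α` a genuine pole, and analyticity pushes it outside the
    -- closed disk.
    have hα : 1 < ‖α‖ := by
      by_contra! hα
      obtain ⟨i, j, hij⟩ : ∃ i j, (C * B) i j ≠ 0 := by
        by_contra! h
        exact hCB (by ext i j; exact h i j)
      have h1 := ((han α hα).matRegAt i j).sub (regAt_C (D i j) α)
      have h2 := h1.mul (regAt_C ((C * B) i j)⁻¹ α)
      apply not_regAt_inv_X_sub_C α (_ : ℂ)
      convert h2 using 1
      rw [hR']
      have : RatFunc.C ((C * B) i j) ≠ 0 := by simpa using hij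
      simp only [const, Matrix.add_apply, Matrix.smul_apply, Matrix.map_apply, smul_eq_mul,
        map_inv₀]
      field_simp
      ring
    refine ⟨star α⁻¹, D - (α - star α⁻¹)⁻¹ • (C * B),
      (-(α * (α - star α⁻¹))⁻¹ • C).submatrix id (fun _ : Unit => 0),
      B.submatrix (fun _ : Unit => 0) id, ?_, ?_, ?_⟩
    · rw [norm_star, norm_inv]; exact inv_lt_one_of_one_lt₀ hα
    · rw [key, Matrix.smul_mul]
      refine smul_ne_zero (neg_ne_zero.2 (inv_ne_zero (mul_ne_zero ?_ ?_))) hCB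
      · rintro rfl; norm_num at hα
      · intro h
        have h1 := congrArg norm (sub_eq_zero.1 h)
        rw [norm_star, norm_inv] at h1
        have : ‖α‖⁻¹ < 1 := inv_lt_one_of_one_lt₀ hα
        linarith
    · rw [key, Matrix.smul_mul, hR', inv_X_sub_C_eq hα, sub_eq_add_neg D, ← neg_smul, const_add,
        const_smul, const_smul, add_smul, mul_smul, add_assoc]
  -- Pole at infinity: a nilpotent `1 × 1` matrix is zero, so `R` is affine in `z`, and `z = b_0`.
  · have hN0 : N = 0 := by
      obtain ⟨k, hk⟩ := hN
      have h1 : N = N 0 0 • 1 := by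
        ext i j
        fin_cases i; fin_cases j
        simp
      rw [h1, smul_pow, one_pow] at hk
      have h2 := congrFun (congrFun hk 0) 0
      simp only [Matrix.smul_apply, Matrix.one_apply_eq, smul_eq_mul, mul_one,
        Matrix.zero_apply] at h2
      rw [h1, eq_zero_of_pow_eq_zero h2, zero_smul]
    have hR' : R = const D + (RatFunc.X : RatFunc ℂ) • const (C' * B') := by
      rw [hR, hN0, const_mul, const_zero, smul_zero, sub_zero, inv_one]
      ext i j
      simp [Matrix.mul_apply]
    refine ⟨0, D, C'.submatrix id (fun _ : Unit => 0), B'.submatrix (fun _ : Unit => 0) id,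
      by simp, ?_, ?_⟩
    · rw [key]
      intro h
      apply h0
      rw [hR', h, const_zero, smul_zero, add_zero]
      exact hasRealization_const D
    · rw [key, hR']
      simp [blaschke]

end Realization

/-! ### Structure of elementary `J`-inner factors -/

section Factor
variable {p : ℕ}

lemma J_mul_J : J p * J p = 1 := by
  rw [J, fromBlocks_multiply, ← fromBlocks_one]; simp

lemma conjTranspose_J : (J p)ᴴ = J p := by
  rw [J, fromBlocks_conjTranspose]; simp

/-- The inverse of a `J`-unitary matrix. -/
lemma J_mul_conjTranspose_mul_J_mul {H : Matrix (Fin p ⊕ Fin p) (Fin p ⊕ Fin p) ℂ}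
    (h : Hᴴ * J p * H = J p) : J p * Hᴴ * J p * H = 1 := by
  rw [Matrix.mul_assoc (J p), Matrix.mul_assoc (J p), h, J_mul_J]

lemma mul_J_mul_conjTranspose {H : Matrix (Fin p ⊕ Fin p) (Fin p ⊕ Fin p) ℂ}
    (h : Hᴴ * J p * H = J p) : H * J p * Hᴴ = J p := by
  have h1 := mul_eq_one_comm.1 (J_mul_conjTranspose_mul_J_mul h)
  calc H * J p * Hᴴ = H * (J p * Hᴴ * J p) * J p := by
        simp only [Matrix.mul_assoc, J_mul_J, Matrix.mul_one]
    _ = J p := by rw [h1, Matrix.one_mul]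

/-- Comparison of Fourier coefficients, recovered from the values at `1`, `-1` and `i`. -/
lemma eq_zero_of_circle {k : Type} {S T Y Z : Matrix k k ℂ}
    (h : ∀ l : ℂ, ‖l‖ = 1 → S + l • Y + star l • Z = T) : S = T ∧ Y = 0 := by
  have h1 := h 1 (by simp)
  have h2 := h (-1) (by simp)
  have h3 := h Complex.I (by simp)
  simp only [star_neg, star_one, Complex.star_def, Complex.conj_I] at h1 h2 h3
  constructor <;> ext i j <;>
    (have e1 := congrFun (congrFun h1 i) j
     have e2 := congrFun (congrFun h2 i) j
     have e3 := congrFun (congrFun h3 i) j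
     simp only [Matrix.add_apply, Matrix.smul_apply, smul_eq_mul] at e1 e2 e3)
  · linear_combination (1 / 2) * e1 + (1 / 2) * e2
  · rw [Matrix.zero_apply]
    linear_combination (1 / 4) * (e1 - e2) - Complex.I / 2 * (e3 - (e1 + e2) / 2) +
      (Y i j - Z i j) / 2 * Complex.I_mul_I

/-- The structure of elementary `J`-inner factors that are analytic on the closed disk. -/
lemma exists_factor {Θ : RatMat (Fin p ⊕ Fin p) (Fin p ⊕ Fin p)} (hΘ : IsElementaryJInner Θ)
    (han : ∀ z : ℂ, ‖z‖ ≤ 1 → AnalyticAtPt Θ z) :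
    ∃ (w : ℂ) (c : Matrix (Fin p ⊕ Fin p) Unit ℂ)
      (M : Matrix (Fin p ⊕ Fin p) (Fin p ⊕ Fin p) ℂ), ‖w‖ < 1 ∧ cᴴ * J p * c = 1 ∧
      Mᴴ * J p * M = J p ∧ Θ = (1 - (1 - blaschke w) • const (c * cᴴ * J p)) * const M := by
  obtain ⟨w, K, c, r, hw, hcr, hR⟩ := exists_eq_const_add_blaschke_smul hΘ.2 han
  -- As `b_w` attains every `l` on the circle, `Θ*JΘ = J` becomes an identity in the free variable
  -- `l`.
  have hcirc : ∀ l : ℂ, ‖l‖ = 1 → (Kᴴ * J p * K + (c * r)ᴴ * J p * (c * r)) +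
      l • (Kᴴ * J p * (c * r)) + star l • ((c * r)ᴴ * J p * K) = J p := by
    intro l hl
    obtain ⟨z, hz, hreg⟩ := exists_regAt_blaschke hw hl
    have hΘz : MatRegAt Θ z (K + l • (c * r)) := by
      rw [hR]; exact (matRegAt_const _ z).add (MatRegAt.smul hreg (matRegAt_const _ z))
    have := (hΘ.1 z hΘz.analyticAtPt).2.1 hz
    rw [hΘz.evalAt_eq] at this
    refine Eq.trans ?_ this
    have hll : l * star l = 1 := by rw [star_mul_self_eq_norm_sq, hl]; simp
    simp only [conjTranspose_add, conjTranspose_smul, Matrix.add_mul, Matrix.mul_add,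
      Matrix.smul_mul, Matrix.mul_smul, smul_add, smul_smul, hll, one_smul]
    abel
  obtain ⟨hS, hY⟩ := eq_zero_of_circle hcirc
  -- `K` is the value of `Θ` at `w`, the zero of `b_w` inside the disk; this inequality fixes the
  -- sign of `c*Jc`.
  have hpsd : (J p - Kᴴ * J p * K).PosSemidef := by
    have hreg : MatRegAt Θ w K := by
      have h1 := regAt_blaschke hw hw.le
      rw [sub_self, zero_div] at h1
      have := (matRegAt_const K w).add (MatRegAt.smul h1 (matRegAt_const (c * r) w))
      rwa [← hR, zero_smul, add_zero] at this
    have := (hΘ.1 w hreg.analyticAtPt).1 hw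
    rwa [hreg.evalAt_eq] at this
  obtain ⟨j, hj⟩ : ∃ j, r () j ≠ 0 := by
    by_contra! h
    exact hcr (by rw [show r = 0 from by ext i j; exact h j, Matrix.mul_zero])
  have hKc : Kᴴ * J p * c = 0 := by
    ext i k
    have := congrFun (congrFun hY i) j
    rw [← Matrix.mul_assoc, Matrix.mul_apply] at this
    simpa [hj] using this
  set σ : ℂ := (cᴴ * J p * c) () () with hσ
  have hσ1 : cᴴ * J p * c = σ • 1 := by ext i k; simp [hσ]
  have hcrcr : (c * r)ᴴ * J p * (c * r) = σ • (rᴴ * r) := by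
    calc _ = rᴴ * (cᴴ * J p * c) * r := by simp only [conjTranspose_mul, Matrix.mul_assoc]
      _ = _ := by rw [hσ1]; simp
  have hσ0 : 0 ≤ σ := by
    have h1 : J p - Kᴴ * J p * K = σ • (rᴴ * r) := by
      rw [← hcrcr]; exact sub_eq_of_eq_add' hS.symm
    rw [h1] at hpsd
    have h2 : 0 ≤ σ * (r () j * star (r () j)) := by
      have := hpsd.diag_nonneg (i := j)
      simpa [Matrix.mul_apply, mul_comm] using this
    rw [star_mul_self_eq_norm_sq] at h2
    have h3 : 0 < ‖r () j‖ ^ 2 := by have := norm_pos_iff.2 hj; positivity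
    rw [← mul_inv_cancel_right₀ (b := ((‖r () j‖ ^ 2 : ℝ) : ℂ)) (by exact_mod_cast h3.ne') σ]
    refine mul_nonneg h2 ?_
    rw [← Complex.ofReal_inv, Complex.zero_le_real]
    positivity
  -- If `c` were neutral, `K` would be `J`-unitary, hence invertible, and `K*Jc = 0` would give `c =
  -- 0`.
  have hσne : σ ≠ 0 := by
    intro h
    rw [hcrcr, h, zero_smul, add_zero] at hS
    have h1 : J p * c = 0 := by
      have : K * J p * Kᴴ * (J p * c) = 0 := by
        rw [Matrix.mul_assoc, ← Matrix.mul_assoc Kᴴ, hKc, Matrix.mul_zero]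
      rw [mul_J_mul_conjTranspose hS, ← Matrix.mul_assoc, J_mul_J, Matrix.one_mul] at this
      rw [this, Matrix.mul_zero]
    apply hcr
    rw [← Matrix.one_mul c, ← J_mul_J, Matrix.mul_assoc (J p), h1, Matrix.mul_zero,
      Matrix.zero_mul]
  obtain ⟨t, ht0, hσt⟩ : ∃ t : ℝ, 0 < t ∧ σ = (t : ℂ) ^ 2 := by
    have h1 : σ = (σ.re : ℂ) := (Complex.eq_re_of_ofReal_le (r := 0) (by simpa using hσ0))
    have h2 : 0 ≤ σ.re := (Complex.le_def.1 hσ0).1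
    have h3 : σ.re ≠ 0 := fun h => hσne (by rw [h1, h, Complex.ofReal_zero])
    refine ⟨√σ.re, Real.sqrt_pos.2 (lt_of_le_of_ne h2 h3.symm), ?_⟩
    rw [← Complex.ofReal_pow, Real.sq_sqrt h2, ← h1]
  have htc : (t : ℂ) ≠ 0 := by exact_mod_cast ht0.ne'
  set c' : Matrix (Fin p ⊕ Fin p) Unit ℂ := (t : ℂ)⁻¹ • c with hc'
  have hst : star ((t : ℂ)⁻¹) = (t : ℂ)⁻¹ := by
    rw [star_inv₀]; congr 1; exact Complex.conj_ofReal _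
  have hc1 : c'ᴴ * J p * c' = 1 := by
    rw [hc', conjTranspose_smul, Matrix.smul_mul, Matrix.smul_mul, Matrix.mul_smul, hσ1, hst,
      smul_smul, smul_smul, hσt]
    convert one_smul ℂ _
    field_simp
  have hcK : c'ᴴ * J p * K = 0 := by
    have := congrArg conjTranspose hKc
    rw [conjTranspose_mul, conjTranspose_mul, conjTranspose_J, conjTranspose_conjTranspose,
      ← Matrix.mul_assoc, conjTranspose_zero] at this
    rw [hc', conjTranspose_smul, Matrix.smul_mul, Matrix.smul_mul, this, smul_zero]
  have hcM : c' * c'ᴴ * J p * (K + c * r) = c * r := by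
    have hcc : c = (t : ℂ) • c' := by rw [hc', smul_inv_smul₀ htc]
    calc _ = c' * (c'ᴴ * J p * K) + c' * ((c'ᴴ * J p * c) * r) := by
          rw [Matrix.mul_add]; simp only [Matrix.mul_assoc]
      _ = c * r := by
          rw [hcK, hcc, Matrix.mul_smul, hc1]; simp
  -- The constant factor is `Θ` at `b_w = 1`. The `J`-orthogonal projection `c'c'*J` splits it into
  -- `cr` and `K`.
  refine ⟨w, c', K + c * r, hw, hc1, ?_, ?_⟩
  · have := hcirc 1 (by simp)
    rw [one_smul, star_one, one_smul] at this
    refine Eq.trans ?_ this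
    rw [conjTranspose_add, Matrix.add_mul, Matrix.add_mul, Matrix.mul_add, Matrix.mul_add]
    abel
  · rw [hR, Matrix.sub_mul, Matrix.one_mul, Matrix.smul_mul, ← const_mul, hcM, const_add,
      sub_smul, one_smul]
    abel

end Factor

/-! ### Reduction to `Θ̂` times a constant -/

section Normal
variable {p : ℕ}

/-- Dividing by `a = ‖x‖` works, and `a` is then exactly the Halmos constant `(1 - ‖v‖²)^{-1/2}`. -/
lemma exists_eq_smul_unit (x y : EuclideanSpace ℂ (Fin p)) (h : ‖x‖ ^ 2 - ‖y‖ ^ 2 = 1) :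
    ∃ (u v : EuclideanSpace ℂ (Fin p)) (a : ℝ), 0 < a ∧ ‖u‖ = 1 ∧ ‖v‖ < 1 ∧
      x = (a : ℂ) • u ∧ y = (a : ℂ) • v ∧ a ^ 2 * (1 - ‖v‖ ^ 2) = 1 := by
  have hx : 0 < ‖x‖ := by
    rcases (norm_nonneg x).lt_or_eq with h1 | h1
    · exact h1
    · rw [← h1] at h; nlinarith [sq_nonneg ‖y‖]
  have hxc : ((‖x‖ : ℝ) : ℂ) ≠ 0 := by exact_mod_cast hx.ne'
  have hnorm : ∀ z : EuclideanSpace ℂ (Fin p), ‖((‖x‖ : ℝ) : ℂ)⁻¹ • z‖ = ‖z‖ / ‖x‖ := by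
    intro z
    rw [norm_smul, norm_inv, Complex.norm_of_nonneg hx.le, inv_mul_eq_div]
  refine ⟨((‖x‖ : ℝ) : ℂ)⁻¹ • x, ((‖x‖ : ℝ) : ℂ)⁻¹ • y, ‖x‖, hx, ?_, ?_, ?_, ?_, ?_⟩
  · rw [hnorm, div_self hx.ne']
  · rw [hnorm, div_lt_one hx]
    nlinarith [norm_nonneg y]
  · rw [smul_inv_smul₀ hxc]
  · rw [smul_inv_smul₀ hxc]
  · rw [hnorm, div_pow]
    field_simp
    linarith

/-- A column `c` with `c* J c = 1` is `H(u v*) [u; 0]`. -/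
lemma exists_eq_halmos_mul {c : Matrix (Fin p ⊕ Fin p) Unit ℂ} (hc : cᴴ * J p * c = 1) :
    ∃ u v : EuclideanSpace ℂ (Fin p), ‖u‖ = 1 ∧ ‖v‖ < 1 ∧
      c = halmos (outer u v) *
        (fromRows (col u) 0 : Matrix (Fin p ⊕ Fin p) Unit ℂ) := by
  set x : EuclideanSpace ℂ (Fin p) := WithLp.toLp 2 fun i => c (Sum.inl i) () with hx
  set y : EuclideanSpace ℂ (Fin p) := WithLp.toLp 2 fun i => c (Sum.inr i) () with hy
  have hcxy : c = fromRows (col x) (col y) := by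
    ext i j
    rcases i with i | i <;> simp [col, hx, hy]
  have hxy : ‖x‖ ^ 2 - ‖y‖ ^ 2 = 1 := by
    have h1 : cᴴ * J p * c = (col x)ᴴ * col x - (col y)ᴴ * col y := by
      rw [hcxy, J]
      ext i j
      simp [Matrix.mul_apply, fromBlocks, Matrix.one_apply, sub_eq_add_neg]
    rw [hc, conjTranspose_col_mul_col, conjTranspose_col_mul_col, ← sub_smul] at h1
    have h2 := congrFun (congrFun h1 ()) ()
    rw [Matrix.smul_apply, Matrix.one_apply_eq, smul_eq_mul, mul_one] at h2
    exact_mod_cast h2.symm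
  obtain ⟨u, v, a, ha0, hu, hv, hxu, hyv, ha⟩ := exists_eq_smul_unit x y hxy
  refine ⟨u, v, hu, hv, ?_⟩
  have hu2 : ((‖u‖ ^ 2 : ℝ) : ℂ) = 1 := by simp [hu]
  have e1 := halmos_smul_outer (v := v) hu 1 ha0 (by simpa using ha)
  rw [one_smul] at e1
  have huu : (col u)ᴴ * col u = 1 := by rw [conjTranspose_col_mul_col, hu2, one_smul]
  have hPc : ∀ z : EuclideanSpace ℂ (Fin p), outer z u * col u = col z := fun z => by
    rw [← col_mul_conjTranspose_col, Matrix.mul_assoc, huu, Matrix.mul_one]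
  have hcol : ∀ z : EuclideanSpace ℂ (Fin p), col ((a : ℂ) • z) = (a : ℂ) • col z := fun z => by
    ext i j; simp [col]
  rw [e1, fromBlocks_mul_fromRows, hcxy, hxu, hyv, hcol, hcol]
  simp only [Matrix.add_mul, Matrix.one_mul, Matrix.smul_mul, hPc, Matrix.mul_zero, add_zero]
  congr 1
  · module
  · simp

/-- An elementary `J`-inner factor that is analytic on the closed disk is `Θ̂(u,v,w)` up to a
constant `J`-unitary factor on the right. -/
lemma exists_eq_thetaHat_mul {Θ : RatMat (Fin p ⊕ Fin p) (Fin p ⊕ Fin p)}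
    (hΘ : IsElementaryJInner Θ) (han : ∀ z : ℂ, ‖z‖ ≤ 1 → AnalyticAtPt Θ z) :
    ∃ (u v : EuclideanSpace ℂ (Fin p)) (w : ℂ) (M : Matrix (Fin p ⊕ Fin p) (Fin p ⊕ Fin p) ℂ),
      ‖u‖ = 1 ∧ ‖v‖ < 1 ∧ ‖w‖ < 1 ∧ Mᴴ * J p * M = J p ∧ Θ = thetaHat u v w * const M := by
  obtain ⟨w, c, M, hw, hc, hM, hfac⟩ := exists_factor hΘ han
  obtain ⟨u, v, hu, hv, hcu⟩ := exists_eq_halmos_mul hc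
  have hv1 : ‖v‖ ^ 2 < 1 := by nlinarith [norm_nonneg v]
  have hH1 : (halmos (outer u v))ᴴ * J p * halmos (outer u v) = J p := by
    have := halmos_smul_outer_J (v := v) hu 1 (by simpa using hv1)
    rwa [one_smul] at this
  have hH2 := halmos_smul_outer_J (v := v) hu (star w) (by
    rw [norm_star]; nlinarith [sq_nonneg ‖w‖, sq_nonneg ‖v‖, norm_nonneg w])
  set H1 := halmos (outer u v)
  set H2 := halmos (star w • outer u v)
  set e : Matrix (Fin p ⊕ Fin p) Unit ℂ := fromRows (col u) 0 with he
  have hee : e * eᴴ = fromBlocks (outer u u) 0 0 0 := by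
    ext i j
    rcases i with i | i <;> rcases j with j | j <;> simp [he, Matrix.mul_apply, col, outer]
  have heeJ : e * eᴴ * J p = e * eᴴ := by
    rw [hee, J, fromBlocks_multiply]; simp
  have hS : S u w = 1 - (1 - blaschke w) • const (e * eᴴ) := by
    rw [hee, S, const_fromBlocks, ← fromBlocks_one, fromBlocks_smul,
      sub_eq_add_neg (fromBlocks _ _ _ _), fromBlocks_neg, fromBlocks_add]
    simp [sub_eq_add_neg]
  -- `J`-unitarity of `H1` conjugates the projection `cc*J` into `diag(uu*, 0)`.
  have hcc : c * cᴴ * J p * H1 = H1 * (e * eᴴ) := by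
    calc c * cᴴ * J p * H1 = H1 * (e * eᴴ * (H1ᴴ * J p * H1)) := by
          rw [hcu]; simp only [conjTranspose_mul, Matrix.mul_assoc]
      _ = _ := by rw [hH1, heeJ]
  have hT : thetaHat u v w =
      (1 - (1 - blaschke w) • const (c * cᴴ * J p)) * const (H1 * H2) := by
    rw [thetaHat, hS, const_mul H1 H2, ← Matrix.mul_assoc]
    congr 1
    rw [Matrix.mul_sub, Matrix.mul_one, Matrix.sub_mul, Matrix.one_mul, Matrix.mul_smul,
      Matrix.smul_mul, ← const_mul, ← const_mul, hcc]
  have hH : (H1 * H2)ᴴ * J p * (H1 * H2) = J p := by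
    calc _ = H2ᴴ * (H1ᴴ * J p * H1) * H2 := by
          simp only [conjTranspose_mul, Matrix.mul_assoc]
      _ = J p := by rw [hH1, hH2]
  set H := H1 * H2
  have hinv := mul_eq_one_comm.1 (J_mul_conjTranspose_mul_J_mul hH)
  -- The new constant is `H⁻¹M`, as `JH*J` inverts the `J`-unitary `H`.
  refine ⟨u, v, w, J p * Hᴴ * J p * M, hu, hv, hw, ?_, ?_⟩
  · calc _ = Mᴴ * J p * ((H * (J p * J p * J p) * Hᴴ) * J p * M) := by
          simp only [conjTranspose_mul, conjTranspose_conjTranspose, conjTranspose_J,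
            Matrix.mul_assoc]
      _ = Mᴴ * J p * ((H * J p * Hᴴ) * J p * M) := by rw [J_mul_J, Matrix.one_mul]
      _ = J p := by rw [mul_J_mul_conjTranspose hH, J_mul_J, Matrix.one_mul, hM]
  · rw [hT, Matrix.mul_assoc, ← const_mul, ← Matrix.mul_assoc H, hinv, Matrix.one_mul, hfac]

end Normal

/-! ### Comparison of coefficients -/

section Constant
variable {p : ℕ}

/-- `A` and `B` are the first two coefficients of the expansion at infinity, so they agree without
knowing `α = α'`, which can fail if `B = 0`. -/
lemma eq_of_add_inv_smul_eq {m n : Type} {A B A' B' : Matrix m n ℂ} {α α' : ℂ}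
    (h : const A + (RatFunc.X - RatFunc.C α : RatFunc ℂ)⁻¹ • const B =
      const A' + (RatFunc.X - RatFunc.C α' : RatFunc ℂ)⁻¹ • const B') : A = A' ∧ B = B' := by
  have key : ∀ i j, A i j = A' i j ∧ B i j = B' i j := by
    intro i j
    have h1 := congrFun (congrFun h i) j
    simp only [const, Matrix.add_apply, Matrix.smul_apply, Matrix.map_apply, smul_eq_mul] at h1
    have hα := X_sub_C_ne_zero α
    have hα' := X_sub_C_ne_zero α'
    have h2 : (RatFunc.X - RatFunc.C α') * ((RatFunc.X - RatFunc.C α) * RatFunc.C (A i j) +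
        RatFunc.C (B i j)) = (RatFunc.X - RatFunc.C α) * ((RatFunc.X - RatFunc.C α') *
          RatFunc.C (A' i j) + RatFunc.C (B' i j)) := by
      field_simp at h1
      linear_combination h1
    have h3 : ∀ z : ℂ, (z - α') * ((z - α) * A i j + B i j) =
        (z - α) * ((z - α') * A' i j + B' i j) := fun z => by
      have hr : ∀ α α' a b : ℂ, RegAt ((RatFunc.X - RatFunc.C α') *
          ((RatFunc.X - RatFunc.C α) * RatFunc.C a + RatFunc.C b)) z
          ((z - α') * ((z - α) * a + b)) := fun α α' a b =>
        ((regAt_X z).sub (regAt_C _ z)).mul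
          ((((regAt_X z).sub (regAt_C _ z)).mul (regAt_C _ z)).add (regAt_C _ z))
      exact (hr α α' _ _).unique (h2 ▸ hr α' α _ _)
    have e0 := h3 0
    have e1 := h3 1
    have e2 := h3 (-1)
    have ea : A i j = A' i j := by linear_combination (e1 + e2 - 2 * e0) / 2
    refine ⟨ea, ?_⟩
    rw [ea] at e1 e2
    linear_combination (e1 - e2) / 2
  exact ⟨by ext i j; exact (key i j).1, by ext i j; exact (key i j).2⟩

/-- Discrete Fourier inversion at the fourth roots of unity. -/
lemma eq_zero_of_circle_cubic {m n : Type} {A B C D : Matrix m n ℂ}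
    (h : ∀ l : ℂ, ‖l‖ = 1 → A + l • B + l ^ 2 • C + l ^ 3 • D = 0) :
    A = 0 ∧ B = 0 ∧ C = 0 ∧ D = 0 := by
  have h1 := h 1 (by simp)
  have h2 := h (-1) (by simp)
  have h3 := h Complex.I (by simp)
  have h4 := h (-Complex.I) (by simp)
  refine ⟨?_, ?_, ?_, ?_⟩ <;> ext i j <;>
    (have e1 := congrFun (congrFun h1 i) j
     have e2 := congrFun (congrFun h2 i) j
     have e3 := congrFun (congrFun h3 i) j
     have e4 := congrFun (congrFun h4 i) j
     have hI := Complex.I_sq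
     have hI3 : Complex.I ^ 3 = -Complex.I := by rw [pow_succ, hI]; ring
     have hI3' : (-Complex.I) ^ 3 = Complex.I := by rw [Odd.neg_pow (by decide), hI3, neg_neg]
     simp only [Matrix.add_apply, Matrix.smul_apply, smul_eq_mul, Matrix.zero_apply, neg_sq, hI,
       hI3, hI3'] at e1 e2 e3 e4 ⊢)
  · linear_combination (e1 + e2 + e3 + e4) / 4
  · linear_combination (e1 - e2) / 4 - Complex.I / 4 * (e3 - e4) + (B i j - D i j) / 2 * hI
  · linear_combination (e1 + e2 - e3 - e4) / 4
  · linear_combination (e1 - e2) / 4 + Complex.I / 4 * (e3 - e4) - (B i j - D i j) / 2 * hI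

open scoped Matrix.Norms.L2Operator in
/-- The unitary matrices span all matrices. -/
lemma eq_zero_of_mul_unitary_mul_eq_zero {Z : Matrix (Fin p) (Fin p) ℂ}
    (h : ∀ G : Matrix (Fin p) (Fin p) ℂ, Gᴴ * G = 1 → Z * G * Z = 0) : Z = 0 := by
  have hspan := CStarAlgebra.span_unitary (Matrix (Fin p) (Fin p) ℂ)
  have hall : ∀ G : Matrix (Fin p) (Fin p) ℂ, Z * G * Z = 0 := by
    intro G
    have hG : G ∈ Submodule.span ℂ (unitary (Matrix (Fin p) (Fin p) ℂ) : Set _) := by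
      rw [hspan]; trivial
    induction hG using Submodule.span_induction with
    | mem x hx => exact h x hx.1
    | zero => simp
    | add x y _ _ hx hy => rw [Matrix.mul_add, Matrix.add_mul, hx, hy, add_zero]
    | smul a x _ hx => rw [Matrix.mul_smul, Matrix.smul_mul, hx, smul_zero]
  -- The choice `G = Z*` gives `ZZ*Z = 0`, so the Hermitian matrix `Z*Z` has zero square.
  have h1 : Zᴴ * Z = 0 := by
    rw [← Matrix.conjTranspose_mul_self_eq_zero, conjTranspose_mul, conjTranspose_conjTranspose,
      Matrix.mul_assoc, ← Matrix.mul_assoc Z, hall, Matrix.mul_zero]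
  exact Matrix.conjTranspose_mul_self_eq_zero.1 h1

end Constant

/-! ### Feedback maps at constant matrices -/

section ConstantUnitary
variable {p : ℕ}

/-- `V diag(1, G) U*` for a constant matrix `G`. -/
def constFmat (U V : BlockMat p) (G : Matrix (Fin p) (Fin p) ℂ) :
    Matrix (Fin p ⊕ Unit) (Fin p ⊕ Unit) ℂ :=
  V * (fromBlocks 1 0 0 G : Matrix (Unit ⊕ Fin p) (Unit ⊕ Fin p) ℂ) * Uᴴ

lemma Fmat_const (U V : BlockMat p) (G : Matrix (Fin p) (Fin p) ℂ) :
    Fmat U V (const G) = const (constFmat U V G) := by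
  rw [Fmat, constFmat, const_mul, const_mul, const_fromBlocks]
  simp

lemma toBlocks₁₁_const {k l m n : Type} (M : Matrix (k ⊕ l) (m ⊕ n) ℂ) :
    (const M).toBlocks₁₁ = const M.toBlocks₁₁ := rfl

lemma toBlocks₁₂_const {k l m n : Type} (M : Matrix (k ⊕ l) (m ⊕ n) ℂ) :
    (const M).toBlocks₁₂ = const M.toBlocks₁₂ := rfl

lemma toBlocks₂₁_const {k l m n : Type} (M : Matrix (k ⊕ l) (m ⊕ n) ℂ) :
    (const M).toBlocks₂₁ = const M.toBlocks₂₁ := rfl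

lemma FUV_const (U V : BlockMat p) (G : Matrix (Fin p) (Fin p) ℂ) :
    FUV U V (const G) = const (constFmat U V G).toBlocks₁₁ +
      (RatFunc.X - RatFunc.C ((constFmat U V G).toBlocks₂₂ () ()))⁻¹ •
        const ((constFmat U V G).toBlocks₁₂ * (constFmat U V G).toBlocks₂₁) := by
  rw [FUV, Fden, Fmat_const, const_mul]
  rfl

/-- Equality of the values of two feedback maps at constant matrices. -/
lemma constFmat_blocks_eq_of_FUV_eq {U V U' V' : BlockMat p} {G G' : Matrix (Fin p) (Fin p) ℂ}
    (h : FUV U V (const G) = FUV U' V' (const G')) :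
    (constFmat U V G).toBlocks₁₁ = (constFmat U' V' G').toBlocks₁₁ ∧
      (constFmat U V G).toBlocks₁₂ * (constFmat U V G).toBlocks₂₁ =
        (constFmat U' V' G').toBlocks₁₂ * (constFmat U' V' G').toBlocks₂₁ := by
  rw [FUV_const, FUV_const] at h
  exact eq_of_add_inv_smul_eq h

lemma constFmat_smul (U V : BlockMat p) (G : Matrix (Fin p) (Fin p) ℂ) :
    ∃ X Y : Matrix (Fin p ⊕ Unit) (Fin p ⊕ Unit) ℂ,
      ∀ l : ℂ, constFmat U V (l • G) = X + l • Y := by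
  refine ⟨V * (fromBlocks 1 0 0 0 : Matrix (Unit ⊕ Fin p) (Unit ⊕ Fin p) ℂ) * Uᴴ,
    V * (fromBlocks 0 0 0 G : Matrix (Unit ⊕ Fin p) (Unit ⊕ Fin p) ℂ) * Uᴴ, fun l => ?_⟩
  rw [constFmat, ← Matrix.smul_mul, ← Matrix.mul_smul, ← Matrix.add_mul, ← Matrix.mul_add,
    fromBlocks_smul, fromBlocks_add]
  simp

/-- The blocks of `V diag(1, l G) U*` depend polynomially on the scalar `l`. -/
lemma exists_constFmat_blocks_smul (U V : BlockMat p) (G : Matrix (Fin p) (Fin p) ℂ) :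
    ∃ A₀ A₁ B₀ B₁ B₂ : Matrix (Fin p) (Fin p) ℂ, ∀ l : ℂ,
      (constFmat U V (l • G)).toBlocks₁₁ = A₀ + l • A₁ ∧
      (constFmat U V (l • G)).toBlocks₁₂ * (constFmat U V (l • G)).toBlocks₂₁ =
        B₀ + l • B₁ + l ^ 2 • B₂ := by
  obtain ⟨X, Y, h⟩ := constFmat_smul U V G
  refine ⟨X.toBlocks₁₁, Y.toBlocks₁₁, X.toBlocks₁₂ * X.toBlocks₂₁,
    X.toBlocks₁₂ * Y.toBlocks₂₁ + Y.toBlocks₁₂ * X.toBlocks₂₁,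
    Y.toBlocks₁₂ * Y.toBlocks₂₁, fun l => ?_⟩
  rw [h]
  refine ⟨rfl, ?_⟩
  have h1 : (X + l • Y).toBlocks₁₂ = X.toBlocks₁₂ + l • Y.toBlocks₁₂ := rfl
  have h2 : (X + l • Y).toBlocks₂₁ = X.toBlocks₂₁ + l • Y.toBlocks₂₁ := rfl
  rw [h1, h2]
  simp only [Matrix.add_mul, Matrix.mul_add, Matrix.smul_mul, Matrix.mul_smul]
  module

lemma constFmat_hat (u v : EuclideanSpace ℂ (Fin p)) (w : ℂ) (G : Matrix (Fin p) (Fin p) ℂ) :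
    (constFmat (Uhat u v w) (Vhat v w) G).toBlocks₁₁ =
      cA v w ^ 2 • outer v u +
        (1 - ((1 - cK v w) / ((‖v‖ ^ 2 : ℝ) : ℂ)) • outer v v) * G *
          (1 - (1 + star w * cK v w) • outer u u) ∧
    (constFmat (Uhat u v w) (Vhat v w) G).toBlocks₁₂ *
        (constFmat (Uhat u v w) (Vhat v w) G).toBlocks₂₁ =
      (cA v w ^ 2 * w * cK v w ^ 2) • outer v u -
        (cA v w ^ 2 * w * cK v w) • (outer v v * G * (1 - (1 + star w * cK v w) • outer u u)) +
        (cA v w ^ 2 * cK v w) •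
          ((1 - ((1 - cK v w) / ((‖v‖ ^ 2 : ℝ) : ℂ)) • outer v v) * (G * outer u u)) -
        cA v w ^ 2 • ((1 - ((1 - cK v w) / ((‖v‖ ^ 2 : ℝ) : ℂ)) • outer v v) *
          (G * (outer u v * (G * (1 - (1 + star w * cK v w) • outer u u))))) := by
  have h := Fmat_hat u v w (const G)
  rw [Fmat_const] at h
  constructor <;> apply const_injective
  · rw [← toBlocks₁₁_const, h, toBlocks_fromBlocks₁₁]
    simp only [const_add, const_mul, const_sub, const_smul, const_one]
  · rw [const_mul, ← toBlocks₁₂_const, ← toBlocks₂₁_const, h, toBlocks_fromBlocks₁₂,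
      toBlocks_fromBlocks₂₁, hat_off_diagonal_mul]
    simp only [const_add, const_mul, const_sub, const_smul, const_one, map_mul, map_pow]

lemma cK_ne_zero {v : EuclideanSpace ℂ (Fin p)} {w : ℂ} (hv : ‖v‖ < 1) (hw : ‖w‖ < 1) :
    cK v w ≠ 0 := by
  obtain ⟨a, b, a0, b0, -, -, hK, -⟩ := exists_normalizations hv hw
  intro h
  rw [h, zero_mul] at hK
  exact b0.ne (by exact_mod_cast hK)

lemma cA_ne_zero {v : EuclideanSpace ℂ (Fin p)} {w : ℂ} (hv : ‖v‖ < 1) (hw : ‖w‖ < 1) :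
    cA v w ≠ 0 := by
  obtain ⟨a, b, a0, b0, -, -, -, hA⟩ := exists_normalizations hv hw
  intro h
  have : 0 < (1 - ‖w‖ ^ 2) * b ^ 2 := mul_pos (by nlinarith [norm_nonneg w]) (by positivity)
  rw [h, zero_pow two_ne_zero] at hA
  exact this.ne (by exact_mod_cast hA)

/-- The Sherman–Morrison formula. -/
lemma exists_inv_one_sub_smul_outer {x : EuclideanSpace ℂ (Fin p)} {c : ℂ}
    (hc : 1 - c * ((‖x‖ ^ 2 : ℝ) : ℂ) ≠ 0) :
    ∃ E, E * (1 - c • outer x x) = 1 ∧ (1 - c • outer x x) * E = 1 := by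
  have h : (1 - (-(c / (1 - c * ((‖x‖ ^ 2 : ℝ) : ℂ)))) • outer x x) * (1 - c • outer x x) = 1 := by
    rw [sub_smul_outer_mul]
    have : (-(c / (1 - c * ((‖x‖ ^ 2 : ℝ) : ℂ))) + c -
        -(c / (1 - c * ((‖x‖ ^ 2 : ℝ) : ℂ))) * c * ((‖x‖ ^ 2 : ℝ) : ℂ)) = 0 := by
      field_simp
      ring
    rw [this, zero_smul, sub_zero]
  exact ⟨_, h, mul_eq_one_comm.1 h⟩

/-- If the values of a feedback map with `Û`, `V̂` at `G' l` agree with those of another feedback map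
at `l G`, then `G' l` is a polynomial of degree at most two in `l`. -/
lemma exists_quadratic {u v : EuclideanSpace ℂ (Fin p)} {w : ℂ} (hu : ‖u‖ = 1) (hv : ‖v‖ < 1)
    (hw : ‖w‖ < 1) (U V : BlockMat p) (G : Matrix (Fin p) (Fin p) ℂ) :
    ∃ A B C : Matrix (Fin p) (Fin p) ℂ, ∀ (l : ℂ) (G' : Matrix (Fin p) (Fin p) ℂ),
      FUV (Uhat u v w) (Vhat v w) (const G') = FUV U V (const (l • G)) →
      G' = A + l • B + l ^ 2 • C := by
  obtain ⟨A₀, A₁, B₀, B₁, B₂, hAB⟩ := exists_constFmat_blocks_smul U V G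
  have hK0 := cK_ne_zero hv hw
  have hA0 := cA_ne_zero hv hw
  have hu2 : ((‖u‖ ^ 2 : ℝ) : ℂ) = 1 := by simp [hu]
  obtain ⟨E', hE', -⟩ := exists_inv_one_sub_smul_outer (x := v)
    (c := (1 - cK v w) / ((‖v‖ ^ 2 : ℝ) : ℂ)) (by
      rw [one_sub_cK_div_mul]; simpa using hK0)
  have hmain : ∀ (l : ℂ) (G' : Matrix (Fin p) (Fin p) ℂ),
      FUV (Uhat u v w) (Vhat v w) (const G') = FUV U V (const (l • G)) → _ := fun l G' h => by
    have h1 := constFmat_blocks_eq_of_FUV_eq h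
    rw [(constFmat_hat u v w G').1, (constFmat_hat u v w G').2, (hAB l).1, (hAB l).2] at h1
    exact h1
  set E := 1 - ((1 - cK v w) / ((‖v‖ ^ 2 : ℝ) : ℂ)) • outer v v with hE
  -- In `F₁` the argument `G'` is multiplied on the right by `T = I - (1 + w̄ cK) uu*`, invertible
  -- exactly when `w ≠ 0`; then `F₁` alone gives `G'`. For `w = 0`, `T` is the projection `I - uu*`:
  -- `F₁` gives `G'T`, while `F₂F₃uu*` gives `G'uu*`, its term quadratic in `G'` being killed by `T
  -- uu* = 0`.
  by_cases hw0 : w = 0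
  · set T : Matrix (Fin p) (Fin p) ℂ := 1 - outer u u with hT
    have hPP : outer u u * outer u u = outer u u := by rw [outer_mul_outer, hu2, one_smul]
    have hTP : T * outer u u = 0 := by rw [hT, Matrix.sub_mul, Matrix.one_mul, hPP, sub_self]
    refine ⟨E' * (A₀ - cA v w ^ 2 • outer v u) +
      (cA v w ^ 2 * cK v w)⁻¹ • (E' * (B₀ * outer u u)),
      E' * A₁ + (cA v w ^ 2 * cK v w)⁻¹ • (E' * (B₁ * outer u u)),
      (cA v w ^ 2 * cK v w)⁻¹ • (E' * (B₂ * outer u u)), fun l G' h => ?_⟩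
    obtain ⟨h1, h2⟩ := hmain l G' h
    have hτ : (1 + star w * cK v w) • outer u u = outer u u := by rw [hw0]; simp
    rw [hτ, ← hT] at h1 h2
    have h3 : E' * (A₀ + l • A₁ - cA v w ^ 2 • outer v u) = G' * T := by
      rw [← h1, add_sub_cancel_left, Matrix.mul_assoc, ← Matrix.mul_assoc, hE', Matrix.one_mul]
    have h4 : (cA v w ^ 2 * cK v w)⁻¹ • (E' * ((B₀ + l • B₁ + l ^ 2 • B₂) * outer u u)) =
        G' * outer u u := by
      have h5 : (B₀ + l • B₁ + l ^ 2 • B₂) * outer u u =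
          (cA v w ^ 2 * cK v w) • (E * (G' * outer u u)) := by
        rw [← h2, hw0]
        simp only [mul_zero, zero_mul, zero_smul, zero_add, Matrix.sub_mul,
          Matrix.smul_mul, Matrix.mul_assoc, hPP, hTP, smul_zero, sub_zero,
          sub_self]
      rw [h5, Matrix.mul_smul, inv_smul_smul₀ (mul_ne_zero (pow_ne_zero 2 hA0) hK0),
        ← Matrix.mul_assoc, hE', Matrix.one_mul]
    have h6 : G' = G' * T + G' * outer u u := by
      rw [hT, ← Matrix.mul_add, sub_add_cancel, Matrix.mul_one]
    rw [h6, ← h3, ← h4]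
    simp only [Matrix.mul_add, Matrix.mul_sub, Matrix.add_mul, Matrix.smul_mul, Matrix.mul_smul]
    module
  · obtain ⟨T', -, hT'⟩ := exists_inv_one_sub_smul_outer (x := u)
      (c := 1 + star w * cK v w) (by
        rw [hu2]
        have : star w * cK v w ≠ 0 := mul_ne_zero (star_ne_zero.2 hw0) hK0
        simpa using this)
    set T := 1 - (1 + star w * cK v w) • outer u u with hT
    refine ⟨E' * (A₀ - cA v w ^ 2 • outer v u) * T', E' * A₁ * T', 0, fun l G' h => ?_⟩
    obtain ⟨h1, -⟩ := hmain l G' h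
    have h3 : E' * (A₀ + l • A₁ - cA v w ^ 2 • outer v u) * T' = G' := by
      rw [← h1, add_sub_cancel_left, Matrix.mul_assoc, Matrix.mul_assoc, Matrix.mul_assoc, hT',
        Matrix.mul_one, ← Matrix.mul_assoc, hE', Matrix.one_mul]
    rw [← h3]
    simp only [Matrix.mul_add, Matrix.mul_sub, Matrix.add_mul, Matrix.sub_mul, Matrix.smul_mul,
      Matrix.mul_smul, smul_zero, add_zero]
    abel

end ConstantUnitary

/-! ### Constant `J`-unitary matrices and part (a) -/

section JUnitary
variable {p : ℕ} {M₁ M₂ M₃ M₄ : Matrix (Fin p) (Fin p) ℂ}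

/-- The block relations of a `J`-unitary matrix. -/
lemma block_relations (h : (fromBlocks M₁ M₂ M₃ M₄)ᴴ * J p * fromBlocks M₁ M₂ M₃ M₄ = J p) :
    M₁ᴴ * M₁ = 1 + M₃ᴴ * M₃ ∧ M₁ᴴ * M₂ = M₃ᴴ * M₄ ∧ M₄ᴴ * M₄ = 1 + M₂ᴴ * M₂ := by
  rw [fromBlocks_conjTranspose, J, fromBlocks_multiply, fromBlocks_multiply] at h
  obtain ⟨h1, h2, -, h4⟩ := fromBlocks_inj.1 h
  simp only [Matrix.mul_one, Matrix.mul_zero, add_zero, zero_add, Matrix.mul_neg,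
    Matrix.neg_mul] at h1 h2 h4
  refine ⟨?_, ?_, ?_⟩
  · rw [← h1, neg_add_cancel_right]
  · exact eq_of_sub_eq_zero (by rw [sub_eq_add_neg]; exact h2)
  · rw [← neg_neg (1 : Matrix (Fin p) (Fin p) ℂ), ← h4]; abel

/-- The linear fractional transformation of a `J`-unitary matrix maps unitary matrices to unitary
matrices. -/
lemma exists_unitary_image (h : (fromBlocks M₁ M₂ M₃ M₄)ᴴ * J p * fromBlocks M₁ M₂ M₃ M₄ = J p)
    {G : Matrix (Fin p) (Fin p) ℂ} (hG : Gᴴ * G = 1) :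
    IsUnit (M₂ * G + M₁) ∧ ∃ G' : Matrix (Fin p) (Fin p) ℂ, G'ᴴ * G' = 1 ∧
      M₄ * G + M₃ = G' * (M₂ * G + M₁) := by
  obtain ⟨h1, h2, h4⟩ := block_relations h
  have h3 : M₂ᴴ * M₁ = M₄ᴴ * M₃ := by
    have := congrArg conjTranspose h2
    simpa only [conjTranspose_mul, conjTranspose_conjTranspose] using this
  have hKL : (M₂ * G + M₁)ᴴ * (M₂ * G + M₁) = (M₄ * G + M₃)ᴴ * (M₄ * G + M₃) := by
    have e1 : (M₂ * G + M₁)ᴴ * (M₂ * G + M₁) = Gᴴ * (M₂ᴴ * M₂) * G + Gᴴ * (M₂ᴴ * M₁) +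
        (M₁ᴴ * M₂) * G + M₁ᴴ * M₁ := by
      rw [conjTranspose_add, conjTranspose_mul]; noncomm_ring
    have e2 : (M₄ * G + M₃)ᴴ * (M₄ * G + M₃) = Gᴴ * (M₄ᴴ * M₄) * G + Gᴴ * (M₄ᴴ * M₃) +
        (M₃ᴴ * M₄) * G + M₃ᴴ * M₃ := by
      rw [conjTranspose_add, conjTranspose_mul]; noncomm_ring
    rw [e1, e2, h1, h2, h3, h4, Matrix.mul_add, Matrix.add_mul, Matrix.mul_one, hG]
    abel
  -- By `hKL` numerator and denominator have the same kernel; this relation makes that kernel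
  -- trivial.
  have hone : M₁ᴴ * (M₂ * G + M₁) - M₃ᴴ * (M₄ * G + M₃) = 1 := by
    rw [Matrix.mul_add, Matrix.mul_add, ← Matrix.mul_assoc, ← Matrix.mul_assoc, h1, h2]
    abel
  have hK : IsUnit (M₂ * G + M₁) := by
    rw [Matrix.isUnit_iff_isUnit_det, isUnit_iff_ne_zero]
    intro hdet
    obtain ⟨x, hx0, hx⟩ := Matrix.exists_mulVec_eq_zero_iff.2 hdet
    have hL : (M₄ * G + M₃) *ᵥ x = 0 := by
      rw [← Matrix.conjTranspose_mul_self_mulVec_eq_zero, ← hKL, ← Matrix.mulVec_mulVec, hx,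
        Matrix.mulVec_zero]
    apply hx0
    rw [← Matrix.one_mulVec x, ← hone, Matrix.sub_mulVec, ← Matrix.mulVec_mulVec,
      ← Matrix.mulVec_mulVec, hx, hL, Matrix.mulVec_zero, Matrix.mulVec_zero, sub_zero]
  have hdet := (Matrix.isUnit_iff_isUnit_det _).1 hK
  refine ⟨hK, (M₄ * G + M₃) * (M₂ * G + M₁)⁻¹, ?_, ?_⟩
  · rw [conjTranspose_mul, Matrix.mul_assoc, ← Matrix.mul_assoc (M₄ * G + M₃)ᴴ, ← hKL,
      Matrix.mul_assoc, Matrix.mul_nonsing_inv _ hdet, Matrix.mul_one, ← conjTranspose_mul,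
      Matrix.mul_nonsing_inv _ hdet, conjTranspose_one]
  · rw [Matrix.mul_assoc, Matrix.nonsing_inv_mul _ hdet, Matrix.mul_one]

/-- A `J`-unitary matrix whose linear fractional transformation is polynomial of degree at most two
along every circle of unitary matrices is block diagonal. -/
lemma eq_diag_of_quadratic
    (h : (fromBlocks M₁ M₂ M₃ M₄)ᴴ * J p * fromBlocks M₁ M₂ M₃ M₄ = J p)
    (hquad : ∀ G : Matrix (Fin p) (Fin p) ℂ, Gᴴ * G = 1 →
      ∃ A B C : Matrix (Fin p) (Fin p) ℂ, ∀ l : ℂ, ‖l‖ = 1 →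
        M₄ * (l • G) + M₃ = (A + l • B + l ^ 2 • C) * (M₂ * (l • G) + M₁)) :
    M₂ = 0 ∧ M₃ = 0 ∧ M₁ᴴ * M₁ = 1 ∧ M₄ᴴ * M₄ = 1 := by
  obtain ⟨h1, h2, h4⟩ := block_relations h
  have hM₁ : IsUnit M₁ := by
    have hpd : (M₁ᴴ * M₁).PosDef := by
      rw [h1]
      exact PosDef.one.add_posSemidef (posSemidef_conjTranspose_mul_self M₃)
    rw [Matrix.isUnit_iff_isUnit_det]
    have := (Matrix.isUnit_iff_isUnit_det _).1 hpd.isUnit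
    rw [det_mul] at this
    exact isUnit_of_mul_isUnit_right this
  have hdet := (Matrix.isUnit_iff_isUnit_det _).1 hM₁
  have hN : M₁ * M₁⁻¹ = 1 := Matrix.mul_nonsing_inv _ hdet
  set N := M₁⁻¹ with hNdef
  have h5 : M₂ᴴ = M₄ᴴ * (M₃ * N) := by
    have := congrArg conjTranspose h2
    rw [conjTranspose_mul, conjTranspose_mul, conjTranspose_conjTranspose,
      conjTranspose_conjTranspose] at this
    rw [← Matrix.mul_assoc, ← this, Matrix.mul_assoc, hN, Matrix.mul_one]
  -- The Schur complement of `M₁` is inverted by `M₄*`; this cancels it from the cubic coefficient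
  -- below.
  have hS : M₄ᴴ * (M₄ - M₃ * N * M₂) = 1 := by
    rw [Matrix.mul_sub, ← Matrix.mul_assoc, ← h5, h4, add_sub_cancel_right]
  have hZ : N * M₂ = 0 := by
    refine eq_zero_of_mul_unitary_mul_eq_zero fun G hG => ?_
    obtain ⟨A, B, C, hABC⟩ := hquad G hG
    -- Clearing the denominator gives a cubic in `l`. The coefficients of degree 0, 1, 2 determine
    -- `A`, `B`, `C`; with `S` the Schur complement, the remaining one, `C M₂ G = 0`, reads `S G (N
    -- M₂) G (N M₂) G = 0`.
    obtain ⟨e0, e1, e2, e3⟩ := eq_zero_of_circle_cubic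
      (A := A * M₁ - M₃) (B := B * M₁ + A * M₂ * G - M₄ * G) (C := C * M₁ + B * M₂ * G)
      (D := C * M₂ * G) fun l hl => by
        have := hABC l hl
        rw [← sub_eq_zero.2 this.symm]
        simp only [Matrix.add_mul, Matrix.mul_add, Matrix.smul_mul, Matrix.mul_smul,
          Matrix.mul_assoc]
        module
    have hA : A = M₃ * N := by
      rw [← sub_eq_zero.1 e0, Matrix.mul_assoc, hN, Matrix.mul_one]
    have hB : B = (M₄ - M₃ * N * M₂) * G * N := by
      have : B * M₁ = (M₄ - M₃ * N * M₂) * G := by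
        rw [← hA, Matrix.sub_mul, eq_sub_iff_add_eq]
        exact sub_eq_zero.1 e1
      rw [← this, Matrix.mul_assoc, hN, Matrix.mul_one]
    have hC : C = -(B * M₂ * G * N) := by
      rw [← neg_mul, ← eq_neg_of_add_eq_zero_left e2, Matrix.mul_assoc, hN, Matrix.mul_one]
    have hG' : G * Gᴴ = 1 := mul_eq_one_comm.1 hG
    have hM : M₄ᴴ * B = G * N := by
      rw [hB, ← Matrix.mul_assoc, ← Matrix.mul_assoc, hS, Matrix.one_mul]
    calc N * M₂ * G * (N * M₂)
        = Gᴴ * (M₄ᴴ * B) * M₂ * G * N * M₂ * (G * Gᴴ) := by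
          rw [hM, ← Matrix.mul_assoc Gᴴ, hG, hG']
          simp only [Matrix.mul_assoc, Matrix.one_mul, Matrix.mul_one]
      _ = -(Gᴴ * M₄ᴴ * (C * M₂ * G) * Gᴴ) := by
          rw [hC]
          simp only [Matrix.mul_assoc, Matrix.neg_mul, Matrix.mul_neg, neg_neg]
      _ = 0 := by rw [e3]; simp
  have hM₂ : M₂ = 0 := by
    rw [← Matrix.one_mul M₂, ← hN, Matrix.mul_assoc, hZ, Matrix.mul_zero]
  have h4' : M₄ᴴ * M₄ = 1 := by rw [h4, hM₂, Matrix.mul_zero, add_zero]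
  have hM₃ : M₃ = 0 := by
    have : M₃ᴴ = 0 := by
      rw [← Matrix.mul_one M₃ᴴ, ← mul_eq_one_comm.1 h4', ← Matrix.mul_assoc, ← h2, hM₂,
        Matrix.mul_zero, Matrix.zero_mul]
    exact conjTranspose_eq_zero.1 this
  exact ⟨hM₂, hM₃, by rw [h1, hM₃, Matrix.mul_zero, add_zero], h4'⟩

/-- If the transformation of `Θ̂ M`, with `M` constant and `J`-unitary, coincides with a feedback map,
then `M` is block diagonal. -/
lemma eq_diagPQ_of_coincide {u v : EuclideanSpace ℂ (Fin p)} {w : ℂ} (hu : ‖u‖ = 1)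
    (hv : ‖v‖ < 1) (hw : ‖w‖ < 1) {M : Matrix (Fin p ⊕ Fin p) (Fin p ⊕ Fin p) ℂ}
    (hM : Mᴴ * J p * M = J p) {U V : BlockMat p}
    (h : CoincideOnLossless (thetaHat u v w * const M) U V) :
    ∃ P Q : Matrix (Fin p) (Fin p) ℂ, P ∈ Matrix.unitaryGroup (Fin p) ℂ ∧
      Q ∈ Matrix.unitaryGroup (Fin p) ℂ ∧ M = diagPQ P Q := by
  rw [← fromBlocks_toBlocks M] at hM
  -- The polynomial for `G' = T_M(lG)` comes from `F_{Û,V̂}(G') = T_Θ̂(G') = T_{Θ̂M}(lG) =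
  -- F_{U,V}(lG)`, with all arguments unitary constants.
  have := eq_diag_of_quadratic hM fun G hG => by
    obtain ⟨A, B, C, hABC⟩ := exists_quadratic hu hv hw U V G
    refine ⟨A, B, C, fun l hl => ?_⟩
    have hlG : (l • G)ᴴ * (l • G) = 1 := by
      rw [conjTranspose_smul, smul_mul_smul_comm, hG, mul_comm, star_mul_self_eq_norm_sq, hl]
      simp
    obtain ⟨hunit, G', hG', hlin⟩ := exists_unitary_image hM hlG
    have hne := (isLossless_const hG').unitaryOnCircle.Fden_ne_zero hu hv hw
    obtain ⟨-, -, hlft⟩ := h _ (isLossless_const hlG)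
    have hunit' : InDomain (const M) (const (l • G)) := by
      rw [InDomain, toBlocks₁₂_const, show (const M).toBlocks₁₁ = const M.toBlocks₁₁ from rfl,
        ← const_mul, ← const_add]
      obtain ⟨X, hX⟩ := hunit.exists_right_inv
      exact IsUnit.of_mul_eq_one (const X) (by rw [← const_mul, hX, const_one])
    have h1 := (inDomain_mul_and_lft_mul (thetaHat u v w) (const M) hunit' (G' := const G') (by
      rw [toBlocks₁₂_const, toBlocks₂₁_const,
        show (const M).toBlocks₁₁ = const M.toBlocks₁₁ from rfl,
        show (const M).toBlocks₂₂ = const M.toBlocks₂₂ from rfl]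
      simp only [← const_mul, ← const_add]
      rw [hlin])).2
    rw [hlin, hABC l G' (by rw [← hlft, h1, (lft_thetaHat_eq_FUV hu hv hw hne).2])]
  obtain ⟨e2, e3, e1, e4⟩ := this
  refine ⟨M.toBlocks₁₁, M.toBlocks₂₂, Matrix.mem_unitaryGroup_iff'.2 e1,
    Matrix.mem_unitaryGroup_iff'.2 e4, ?_⟩
  conv_lhs => rw [← fromBlocks_toBlocks M, e2, e3]
  rfl

end JUnitary

end Lossless

end

theorem theorem6p4 {p : ℕ}
    (Θ : Lossless.RatMat (Fin p ⊕ Fin p) (Fin p ⊕ Fin p))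
    (hΘ : Lossless.IsElementaryJInner Θ)
    (hanalytic : ∀ z : ℂ, ‖z‖ ≤ 1 → Lossless.AnalyticAtPt Θ z) :
    ((∃ U V : Lossless.BlockMat p,
        Lossless.IsUnitary U ∧ Lossless.IsUnitary V ∧ Lossless.CoincideOnLossless Θ U V) →
      ∃ (u v : EuclideanSpace ℂ (Fin p)) (w : ℂ) (P Q : Matrix (Fin p) (Fin p) ℂ),
        ‖u‖ = 1 ∧ ‖v‖ < 1 ∧ ‖w‖ < 1 ∧
        P ∈ Matrix.unitaryGroup (Fin p) ℂ ∧ Q ∈ Matrix.unitaryGroup (Fin p) ℂ ∧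
        Θ = Lossless.thetaHat u v w * Lossless.const (Lossless.diagPQ P Q)) ∧
    (∀ (u v : EuclideanSpace ℂ (Fin p)) (w : ℂ) (P Q : Matrix (Fin p) (Fin p) ℂ),
        ‖u‖ = 1 → ‖v‖ < 1 → ‖w‖ < 1 →
        P ∈ Matrix.unitaryGroup (Fin p) ℂ → Q ∈ Matrix.unitaryGroup (Fin p) ℂ →
        Θ = Lossless.thetaHat u v w * Lossless.const (Lossless.diagPQ P Q) →
        Lossless.IsUnitary (Lossless.Uhat u v w * Lossless.diagOne P) ∧
        Lossless.IsUnitary (Lossless.Vhat v w * Lossless.diagOne Q) ∧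
        Lossless.CoincideOnLossless Θ
          (Lossless.Uhat u v w * Lossless.diagOne P) (Lossless.Vhat v w * Lossless.diagOne Q)) := by
  refine ⟨?_, ?_⟩
  · rintro ⟨U, V, -, -, hUV⟩
    obtain ⟨u, v, w, M, hu, hv, hw, hM, rfl⟩ := Lossless.exists_eq_thetaHat_mul hΘ hanalytic
    obtain ⟨P, Q, hP, hQ, rfl⟩ := Lossless.eq_diagPQ_of_coincide hu hv hw hM hUV
    exact ⟨u, v, w, P, Q, hu, hv, hw, hP, hQ, rfl⟩
  · rintro u v w P Q hu hv hw hP hQ rfl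
    exact ⟨(Lossless.isUnitary_Uhat hu hv hw).mul_diagOne (Matrix.mem_unitaryGroup_iff'.1 hP),
      (Lossless.isUnitary_Vhat hv hw).mul_diagOne (Matrix.mem_unitaryGroup_iff'.1 hQ),
      Lossless.coincideOnLossless_hat hu hv hw hP hQ⟩
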